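/- For $n\ge 0$ let $\mathfrak{nil}_n$ be the Lie ring of strictly upper triangular $n\times n$ matrices over $\mathbb{Z}$, with the matrix units $e_{ij}$ ($1\le i<j\le n$) as basis. Let $\Lambda^*\mathfrak{nil}_n$ be its Chevalley complex, with boundary $$\partial(x_1\wedge\dots\wedge x_k)=\sum_{i<j}(-1)^{i+j}[x_i,x_j]\wedge x_1\wedge\dots\widehat{x_i}\dots\widehat{x_j}\dots\wedge x_k .$$ The modified weight of a wedge $e_{a_1b_1}\wedge\dots\wedge e_{a_kb_k}$ is the vector $(w_1,\dots,w_n)$ with $w_i=i-|\{r: b_r=i\}|+|\{r: a_r=i\}|$. For $w\in\mathbb{Z}^n$ let $[\![w]\!]$ be the subcomplex of $\Lambda^*\mathfrak{nil}_n$ spanned by the wedges of matrix units of modified weight $w$ (it is zero if there are none). For an integer $k$ let $[\![w]\!]_k$ be the complex $[\![w]\!]$ shifted up by $k$: its degree $j$ part is the degree $j-k$ part of $[\![w]\!]$. The cone of a chain map $\varphi:B_*\to C_*$ is the complex with degree $j$ part $B_{j-1}\oplus C_j$ and boundary $(b,c)\mapsto(-\partial b,\varphi(b)+\partial c)$. **Lemma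 3.4.** Let $n\ge 3$ and $1\le k\le n-2$, and let $w_2,\dots,w_k,w_{k+3},\dots,w_n$ be integers. Put $$w=(2,w_2,\dots,w_k,3,3,w_{k+3},\dots,w_n)\in\mathbb{Z}^n,\qquad w'=(w_2-2,\dots,w_k-2,3,w_{k+3}-2,\dots,w_n-2)\in\mathbb{Z}^{n-2}.$$ Then for every $j\in\mathbb{Z}$ $$H_j[\![w]\!]\;\cong\;H_j\,\mathrm{Cone}\bigl([\![w']\!]_k\xrightarrow{\;\cdot 2\;}[\![w']\!]_k\bigr).$$ -/

import Mathlib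

noncomputable section

namespace NilTorsion

open CategoryTheory

/-! ### The Chevalley complex of a Lie algebra -/

section Chevalley

variable {R L : Type*} [CommRing R] [LieRing L] [LieAlgebra R L]

/-- Left multiplication by a vector, as a bilinear map. -/
def wedgeLeft : L →ₗ[R] ExteriorAlgebra R L →ₗ[R] ExteriorAlgebra R L :=
  (LinearMap.mul R (ExteriorAlgebra R L)).comp (ExteriorAlgebra.ι R)

theorem wedgeLeft_apply (x : L) (u : ExteriorAlgebra R L) :
    wedgeLeft x u = ExteriorAlgebra.ι R x * u := rfl

theorem ι_mul_ι_mul (x y : L) (u : ExteriorAlgebra R L) :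
    ExteriorAlgebra.ι R x * (ExteriorAlgebra.ι R y * u)
      = -(ExteriorAlgebra.ι R y * (ExteriorAlgebra.ι R x * u)) := by
  have h := ExteriorAlgebra.ι_add_mul_swap (R := R) x y
  rw [← mul_assoc, ← mul_assoc, eq_neg_of_add_eq_zero_left h, neg_mul]

theorem ι_mul_self_mul (x : L) (u : ExteriorAlgebra R L) :
    ExteriorAlgebra.ι R x * (ExteriorAlgebra.ι R x * u) = 0 := by
  rw [← mul_assoc, ExteriorAlgebra.ι_sq_zero, zero_mul]

/-- One step of the recursion for `adExt x`. -/
def adStep (x : L) : L →ₗ[R] (ExteriorAlgebra R L × ExteriorAlgebra R L) →ₗ[R]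
    ExteriorAlgebra R L :=
  (wedgeLeft.comp (LieAlgebra.ad R L x)).compl₂ (LinearMap.fst R _ _) +
    wedgeLeft.compl₂ (LinearMap.snd R _ _)

theorem adStep_apply (x y : L) (u v : ExteriorAlgebra R L) :
    adStep x y (u, v) = ExteriorAlgebra.ι R ⁅x, y⁆ * u + ExteriorAlgebra.ι R y * v := rfl

theorem adStep_adStep (x y : L) (u v : ExteriorAlgebra R L) :
    adStep x y (ExteriorAlgebra.ι R y * u, adStep x y (u, v)) = (0 : QuadraticForm R L) y • v := by
  simp only [adStep_apply, mul_add, ι_mul_self_mul, ι_mul_ι_mul ⁅x, y⁆ y]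
  simp

/-- The action of `x` on the exterior algebra, i.e. the derivation that extends `ad x`. -/
def adExt (x : L) : ExteriorAlgebra R L →ₗ[R] ExteriorAlgebra R L :=
  CliffordAlgebra.foldr' 0 (adStep x) (adStep_adStep x) 0

@[simp] theorem adExt_one (x : L) : adExt x (1 : ExteriorAlgebra R L) = 0 := by
  have h := CliffordAlgebra.foldr'_algebraMap (R := R) (Q := 0) (adStep x) (adStep_adStep x) 0 1
  rw [map_one, smul_zero] at h
  exact h

@[simp] theorem adExt_ι_mul (x y : L) (u : ExteriorAlgebra R L) :
    adExt x (ExteriorAlgebra.ι R y * u)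
      = ExteriorAlgebra.ι R ⁅x, y⁆ * u + ExteriorAlgebra.ι R y * adExt x u :=
  CliffordAlgebra.foldr'_ι_mul (R := R) (Q := 0) (adStep x) _ 0 y u

/-- Induction over the exterior algebra by left multiplication with vectors. -/
theorem ext_induction {P : ExteriorAlgebra R L → Prop} (one : P 1)
    (add : ∀ u v, P u → P v → P (u + v)) (smul : ∀ (r : R) u, P u → P (r • u))
    (ι_mul : ∀ (y : L) u, P u → P (ExteriorAlgebra.ι R y * u)) (u : ExteriorAlgebra R L) : P u := by
  refine CliffordAlgebra.left_induction (Q := 0) (P := P) (fun r => ?_) add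
    (fun u y hu => ι_mul y u hu) u
  rw [Algebra.algebraMap_eq_smul_one]
  exact smul r 1 one

theorem adExt_lie (x y : L) (u : ExteriorAlgebra R L) :
    adExt x (adExt y u) = adExt ⁅x, y⁆ u + adExt y (adExt x u) := by
  induction u using ext_induction with
  | one => simp
  | add u v hu hv => simp only [map_add, hu, hv]; abel
  | smul r u hu => simp only [map_smul, hu, smul_add]
  | ι_mul z u hu =>
    simp only [adExt_ι_mul, map_add, hu, lie_lie, map_sub, sub_mul, mul_add]
    abel

variable (R L) in
/-- `x ↦ adExt x` as a bilinear map. -/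
def adExtLin : L →ₗ[R] ExteriorAlgebra R L →ₗ[R] ExteriorAlgebra R L where
  toFun := adExt
  map_add' x y := by
    refine LinearMap.ext fun u => ?_
    induction u using ext_induction with
    | one => simp
    | add u v hu hv => simp only [map_add, hu, hv]
    | smul r u hu => simp only [map_smul, hu]
    | ι_mul z u hu =>
      simp only [LinearMap.add_apply] at hu
      simp only [LinearMap.add_apply, adExt_ι_mul, hu, add_lie, map_add, add_mul, mul_add]
      abel
  map_smul' r x := by
    refine LinearMap.ext fun u => ?_
    induction u using ext_induction with
    | one => simp
    | add u v hu hv => simp only [map_add, hu, hv]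
    | smul r u hu => simp only [map_smul, hu]
    | ι_mul z u hu =>
      simp only [LinearMap.smul_apply, RingHom.id_apply] at hu
      simp [adExt_ι_mul, hu]

/-- One step of the recursion for `boundary`. -/
def boundaryStep : L →ₗ[R] (ExteriorAlgebra R L × ExteriorAlgebra R L) →ₗ[R]
    ExteriorAlgebra R L :=
  -((adExtLin R L).compl₂ (LinearMap.fst R _ _) + wedgeLeft.compl₂ (LinearMap.snd R _ _))

theorem boundaryStep_apply (x : L) (u v : ExteriorAlgebra R L) :
    boundaryStep x (u, v) = -(adExt x u + ExteriorAlgebra.ι R x * v) := rfl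

theorem boundaryStep_boundaryStep (x : L) (u v : ExteriorAlgebra R L) :
    boundaryStep x (ExteriorAlgebra.ι R x * u, boundaryStep x (u, v))
      = (0 : QuadraticForm R L) x • v := by
  simp only [boundaryStep_apply, adExt_ι_mul, mul_add, mul_neg, ι_mul_self_mul]
  simp

variable (R L) in
/-- The Chevalley boundary `∂` on the exterior algebra of a Lie algebra, defined by `∂ 1 = 0` and
`∂ (x ∧ u) = -(x · u) - x ∧ ∂ u`. The closed formula
`∂ (x₁ ∧ ⋯ ∧ xₖ) = ∑_{i < j} (-1)^{i+j} [xᵢ, xⱼ] ∧ x₁ ∧ ⋯ x̂ᵢ ⋯ x̂ⱼ ⋯ ∧ xₖ`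
is `boundary_prod` below. -/
def boundary : ExteriorAlgebra R L →ₗ[R] ExteriorAlgebra R L :=
  CliffordAlgebra.foldr' 0 boundaryStep boundaryStep_boundaryStep 0

@[simp] theorem boundary_one : boundary R L 1 = 0 := by
  have h := CliffordAlgebra.foldr'_algebraMap (R := R) (M := L) (Q := 0) boundaryStep boundaryStep_boundaryStep 0 1
  rw [map_one, smul_zero] at h
  exact h

@[simp] theorem boundary_ι_mul (x : L) (u : ExteriorAlgebra R L) :
    boundary R L (ExteriorAlgebra.ι R x * u)
      = -(adExt x u + ExteriorAlgebra.ι R x * boundary R L u) :=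
  CliffordAlgebra.foldr'_ι_mul (R := R) (Q := 0) boundaryStep _ 0 x u

theorem boundary_adExt (x : L) (u : ExteriorAlgebra R L) :
    boundary R L (adExt x u) = adExt x (boundary R L u) := by
  induction u using ext_induction with
  | one => simp
  | add u v hu hv => simp only [map_add, hu, hv]
  | smul r u hu => simp only [map_smul, hu]
  | ι_mul z u hu =>
    simp only [adExt_ι_mul, boundary_ι_mul, map_add, map_neg, hu, adExt_lie x z]
    abel

theorem boundary_boundary (u : ExteriorAlgebra R L) : boundary R L (boundary R L u) = 0 := by
  induction u using ext_induction with
  | one => simp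
  | add u v hu hv => simp only [map_add, hu, hv, add_zero]
  | smul r u hu => simp only [map_smul, hu, smul_zero]
  | ι_mul z u hu =>
    simp only [boundary_ι_mul, map_add, map_neg, hu, boundary_adExt, mul_zero]
    abel

variable (R) in
/-- The wedge `x₁ ∧ ⋯ ∧ xₖ` of a list of vectors. -/
def wedgeList (l : List L) : ExteriorAlgebra R L := (l.map (ExteriorAlgebra.ι R)).prod

theorem wedgeList_cons (x : L) (l : List L) :
    wedgeList R (x :: l) = ExteriorAlgebra.ι R x * wedgeList R l := by
  simp [wedgeList]

theorem adExt_wedgeList (x : L) (l : List L) :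
    adExt x (wedgeList R l) = ∑ j : Fin l.length,
      (-1 : R) ^ (j : ℕ) • wedgeList R (⁅x, l.get j⁆ :: l.eraseIdx j) := by
  induction l with
  | nil => simp [wedgeList]
  | cons y l ih =>
    rw [wedgeList_cons, adExt_ι_mul, ih]
    simp only [List.length_cons, Fin.sum_univ_succ, Finset.mul_sum]
    simp [wedgeList_cons, pow_succ, ι_mul_ι_mul y]

/-- The closed formula for the boundary (with indices counted from `0`, which does not change the
parity of `i + j`). -/
theorem boundary_prod (l : List L) :
    boundary R L (wedgeList R l) = ∑ i : Fin l.length, ∑ j : Fin l.length,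
      if i < j then (-1 : R) ^ ((i : ℕ) + (j : ℕ)) •
        wedgeList R (⁅l.get i, l.get j⁆ :: (l.eraseIdx j).eraseIdx i) else 0 := by
  induction l with
  | nil => simp [wedgeList]
  | cons y l ih =>
    rw [wedgeList_cons, boundary_ι_mul, ih, adExt_wedgeList]
    simp only [List.length_cons, Fin.sum_univ_succ, Finset.mul_sum]
    simp [wedgeList_cons, pow_succ, ι_mul_ι_mul y, pow_add, apply_ite]
    rw [add_comm, add_right_inj, ← Finset.sum_neg_distrib]
    refine Finset.sum_congr rfl fun i _ => ?_
    rw [← Finset.sum_neg_distrib]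
    refine Finset.sum_congr rfl fun j _ => ?_
    split_ifs <;> simp

end Chevalley

/-! ### The Lie ring of strictly upper triangular integral matrices -/

attribute [local instance 100] LieRing.ofAssociativeRing

/-- The Lie ring of strictly upper triangular `n × n` matrices with entries in `ℤ`. -/
def nil (n : ℕ) : LieSubalgebra ℤ (Matrix (Fin n) (Fin n) ℤ) where
  carrier := {A | ∀ i j, j ≤ i → A i j = 0}
  add_mem' {A B} hA hB i j h := by simp [hA i j h, hB i j h]
  zero_mem' := by simp
  smul_mem' c A hA i j h := by simp [hA i j h]
  lie_mem' {A B} hA hB i j h := by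
    have key : ∀ A B : Matrix (Fin n) (Fin n) ℤ, (∀ i j, j ≤ i → A i j = 0) →
        (∀ i j, j ≤ i → B i j = 0) → (A * B) i j = 0 := by
      intro A B hA hB
      rw [Matrix.mul_apply]
      refine Finset.sum_eq_zero fun k _ => ?_
      rcases le_total k i with hk | hk
      · rw [hA i k hk, zero_mul]
      · rw [hB k j (h.trans hk), mul_zero]
    rw [Ring.lie_def, Matrix.sub_apply, key A B hA hB, key B A hB hA, sub_zero]

/-- Positions strictly above the diagonal. -/
abbrev Pos (n : ℕ) : Type := {p : Fin n × Fin n // p.1 < p.2}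

/-- The matrix unit `e_{ab}`, `a < b`, as an element of `nil n`. -/
def e {n : ℕ} (p : Pos n) : nil n :=
  ⟨Matrix.single p.1.1 p.1.2 1, fun i j h => by
    rw [Matrix.single_apply, if_neg]
    rintro ⟨rfl, rfl⟩
    exact absurd p.2 (not_lt.mpr h)⟩

/-- `[e_{ab}, e_{cd}]` equals `e_{ad}` if `b = c`, equals `-e_{cb}` if `a = d`, and `0` otherwise. -/
theorem lie_e {n : ℕ} (p q : Pos n) :
    ⁅e p, e q⁆ =
      if h : p.1.2 = q.1.1 then
        e ⟨(p.1.1, q.1.2), lt_trans p.2 (lt_of_eq_of_lt h q.2)⟩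
      else if h : p.1.1 = q.1.2 then
        -e ⟨(q.1.1, p.1.2), lt_trans q.2 (lt_of_eq_of_lt h.symm p.2)⟩
      else 0 := by
  obtain ⟨⟨a, b⟩, hab⟩ := p
  obtain ⟨⟨c, d⟩, hcd⟩ := q
  apply Subtype.ext
  dsimp only at hab hcd
  rw [LieSubalgebra.coe_bracket, Ring.lie_def]
  dsimp only [e]
  split_ifs with h h'
  · subst h
    have : a ≠ d := (hab.trans hcd).ne
    simp [Matrix.single_mul_single_of_ne _ _ _ _ this.symm]
  · subst h'
    simp [Matrix.single_mul_single_of_ne _ _ _ _ h]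
  · simp [Matrix.single_mul_single_of_ne _ _ _ _ h,
      Matrix.single_mul_single_of_ne _ _ _ _ (Ne.symm h')]

/-- The wedge `e_{a₁b₁} ∧ ⋯ ∧ e_{aₖbₖ}` in the exterior algebra of `nil n`. -/
def wedge {n : ℕ} (l : List (Pos n)) : ExteriorAlgebra ℤ (nil n) := wedgeList ℤ (l.map e)

/-- The weight of `e_{a₁b₁} ∧ ⋯ ∧ e_{aₖbₖ}` at the index `i`: the number of times `i` appears on
the right minus the number of times `i` appears on the left. -/
def weight {n : ℕ} (l : List (Pos n)) (i : Fin n) : ℤ :=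
  (l.countP fun p => p.1.2 = i : ℤ) - (l.countP fun p => p.1.1 = i : ℤ)

/-- The modified weight `(1, …, n) - weight`. (`Fin n` counts from `0`, hence `i + 1`.) -/
def modWeight {n : ℕ} (l : List (Pos n)) (i : Fin n) : ℤ := ((i : ℕ) : ℤ) + 1 - weight l i

/-- The degree `k` part of `⟦w⟧`: the span of the wedges of `k` matrix units that have modified
weight `w`. (A wedge with a repeated factor is zero, and the order of the factors only matters up
to sign, so this is the span of the corresponding basis elements `e_M`.) -/
def bracketSub {n : ℕ} (w : Fin n → ℤ) (k : ℤ) : Submodule ℤ (ExteriorAlgebra ℤ (nil n)) :=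
  Submodule.span ℤ {u | ∃ l : List (Pos n), (l.length : ℤ) = k ∧ modWeight l = w ∧ u = wedge l}

theorem wedge_mem {n : ℕ} (l : List (Pos n)) : wedge l ∈ bracketSub (modWeight l) l.length :=
  Submodule.subset_span ⟨l, rfl, rfl, rfl⟩

theorem wedge_cons {n : ℕ} (p : Pos n) (l : List (Pos n)) :
    wedge (p :: l) = ExteriorAlgebra.ι ℤ (e p) * wedge l := by
  simp [wedge, wedgeList_cons]

theorem weight_cons {n : ℕ} (p : Pos n) (l : List (Pos n)) (i : Fin n) :
    weight (p :: l) i = weight [p] i + weight l i := by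
  simp only [weight, List.countP_cons, List.countP_nil]
  push_cast
  ring

theorem ι_mul_mem {n : ℕ} {w : Fin n → ℤ} {k : ℤ} {u : ExteriorAlgebra ℤ (nil n)}
    (hu : u ∈ bracketSub w k) (p : Pos n) :
    ExteriorAlgebra.ι ℤ (e p) * u ∈ bracketSub (fun i => w i - weight [p] i) (k + 1) := by
  induction hu using Submodule.span_induction with
  | mem u hu =>
    obtain ⟨l, rfl, rfl, rfl⟩ := hu
    rw [← wedge_cons]
    refine Submodule.subset_span ⟨p :: l, by simp, ?_, rfl⟩
    funext i
    simp only [modWeight, weight_cons p l]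
    ring
  | zero => simp
  | add u v _ _ hu hv => rw [mul_add]; exact add_mem hu hv
  | smul c u _ hu => rw [mul_smul_comm]; exact Submodule.smul_mem _ c hu

theorem lie_mul_mem {n : ℕ} {w : Fin n → ℤ} {k : ℤ} {u : ExteriorAlgebra ℤ (nil n)}
    (hu : u ∈ bracketSub w k) (p q : Pos n) :
    ExteriorAlgebra.ι ℤ ⁅e p, e q⁆ * u
      ∈ bracketSub (fun i => w i - weight [p] i - weight [q] i) (k + 1) := by
  rw [lie_e]
  split_ifs with h h'
  · convert ι_mul_mem hu ⟨(p.1.1, q.1.2), lt_trans p.2 (lt_of_eq_of_lt h q.2)⟩ using 3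
    simp only [weight, List.countP_cons, List.countP_nil, h]
    push_cast
    ring
  · rw [map_neg, neg_mul]
    refine neg_mem ?_
    convert ι_mul_mem hu ⟨(q.1.1, p.1.2), lt_trans q.2 (lt_of_eq_of_lt h'.symm p.2)⟩ using 3
    simp only [weight, List.countP_cons, List.countP_nil, h']
    push_cast
    ring
  · simp

theorem adExt_wedge_mem {n : ℕ} (p : Pos n) (l : List (Pos n)) :
    adExt (e p) (wedge l) ∈ bracketSub (modWeight (p :: l)) l.length := by
  induction l with
  | nil => simp [wedge, wedgeList]
  | cons q l ih =>
    rw [wedge_cons, adExt_ι_mul]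
    refine add_mem ?_ ?_
    · convert lie_mul_mem (wedge_mem l) p q using 2
      · funext i
        simp only [modWeight, weight_cons p (q :: l), weight_cons q l]
        ring
      · simp
    · convert ι_mul_mem ih q using 2
      · funext i
        simp only [modWeight, weight_cons p (q :: l), weight_cons q l, weight_cons p l]
        ring
      · simp

/-- Every summand of `∂ (e_M)` has the same weight as `e_M`. -/
theorem boundary_wedge_mem {n : ℕ} (l : List (Pos n)) :
    boundary ℤ (nil n) (wedge l) ∈ bracketSub (modWeight l) (l.length - 1) := by
  induction l with
  | nil => simp [wedge, wedgeList]
  | cons p l ih =>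
    rw [wedge_cons, boundary_ι_mul]
    refine neg_mem (add_mem ?_ ?_)
    · convert adExt_wedge_mem p l using 2
      simp
    · convert ι_mul_mem ih p using 2
      · funext i
        simp only [modWeight, weight_cons p l]
        ring
      · simp

theorem boundary_mem {n : ℕ} {w : Fin n → ℤ} {i j : ℤ} (h : j + 1 = i)
    {u : ExteriorAlgebra ℤ (nil n)} (hu : u ∈ bracketSub w i) :
    boundary ℤ (nil n) u ∈ bracketSub w j := by
  obtain rfl : j = i - 1 := by omega
  induction hu using Submodule.span_induction with
  | mem u hu =>
    obtain ⟨l, rfl, rfl, rfl⟩ := hu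
    exact boundary_wedge_mem l
  | zero => simp
  | add u v _ _ hu hv => rw [map_add]; exact add_mem hu hv
  | smul c u _ hu => rw [map_smul]; exact Submodule.smul_mem _ c hu

/-! ### The complexes -/

/-- The chain complex `⟦w⟧` of abelian groups: the subcomplex of the Chevalley complex of `nil n`
that is spanned by the wedges of modified weight `w`. -/
def bracketComplex {n : ℕ} (w : Fin n → ℤ) : ChainComplex (ModuleCat.{0} ℤ) ℤ where
  X k := ModuleCat.of ℤ (bracketSub w k)
  d i j :=
    if h : j + 1 = i then
      ModuleCat.ofHom ((boundary ℤ (nil n)).restrict fun _ hu => boundary_mem h hu)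
    else 0
  shape i j h := dif_neg h
  d_comp_d' i j k hij hjk := by
    have h1 : j + 1 = i := hij
    have h2 : k + 1 = j := hjk
    rw [dif_pos h1, dif_pos h2, ← ModuleCat.ofHom_comp]
    refine ModuleCat.hom_ext (LinearMap.ext fun u => ?_)
    exact Subtype.ext (boundary_boundary (u : ExteriorAlgebra ℤ (nil n)))

/-- The complex `C` shifted up by `k`: its degree `j` part is `C_{j-k}`. -/
def shift (C : ChainComplex (ModuleCat.{0} ℤ) ℤ) (k : ℤ) : ChainComplex (ModuleCat.{0} ℤ) ℤ where
  X j := C.X (j - k)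
  d i j := C.d (i - k) (j - k)
  shape i j h := C.shape _ _ fun h' => h (by
    have : j - k + 1 = i - k := h'
    change j + 1 = i
    omega)
  d_comp_d' _ _ _ _ _ := C.d_comp_d _ _ _

/-- The cone of multiplication by `m` on `C`. Its degree `j` part is `C_{j-1} ⊕ C_j`. -/
def coneMul (m : ℤ) (C : ChainComplex (ModuleCat.{0} ℤ) ℤ) : ChainComplex (ModuleCat.{0} ℤ) ℤ :=
  HomologicalComplex.homotopyCofiber (m • 𝟙 C)

end NilTorsion

end

noncomputable section

namespace NilTorsion

/-! Count indices from 0. Let `r = (p, q)`, `q = p + 1`, be the pair of indices carrying the two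
entries 3, and let α be the weight of `e r`. As p and q are neighbours, `e r` is never a bracket of
matrix units, so the wedges that avoid `e r` span a subcomplex V (`freeSub`). Hence ⟦w⟧ = e_r ∧
V_{w+α} ⊕ V_w, which is up to signs the cone of E : V_{w+α} → V_w, where E is the action of `e r`
and commutes with ∂.

The transpose of `e r` acts on V by an operator F (`lower`), and E, F satisfy the sl₂ relation
(`raise_lower`). Counting matrix units (`freeSub_eq_zero`) shows that on the line w + ℤα only
V_{w+2α}, V_{w+α}, V_w, V_{w-α} can be nonzero; their sl₂ weights are -3, -1, 1, 3. Therefore E is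
injective on V_{w+α} (`raise_injective`), EF = 3 on V_{w-α} (`raise_lower_top`), and v in V_w lies
in E V_{w+α} as soon as Ev is divisible by 2 in V_{w-α} (`exists_raise_eq`); conversely E² = 2E⁽²⁾
with an integral divided square E⁽²⁾ (`divExt`). So E induces V_w / E V_{w+α} ≅ V_{w-α} / 2, and ⟦w⟧
has the homology of the cone of 2 on V_{w-α}. The comparison map is e_r ∧ u + v ↦ (-E⁽²⁾u, Ev).

Finally V_{w-α} is a copy of ⟦w'⟧ shifted by p (`topEquiv`): the weight at q is extremal, so every
unit (t, q) with t < p occurs and row q is empty; the entry 2 at index 0 allows one unit in row 0,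
which is then (0, q). What remains is a wedge on the indices other than 0 and q. -/

open CategoryTheory

/-! ### Homology of complexes of abelian groups and of the cone of multiplication by m -/

section Homology

variable {A B : ChainComplex (ModuleCat.{0} ℤ) ℤ}

theorem exists_homologyπ (K : ChainComplex (ModuleCat.{0} ℤ) ℤ) {i : ℤ} (j : ℤ)
    (t : K.homology i) :
    ∃ c : K.cycles i, K.homologyπ i c = t ∧ K.d i j (K.iCycles i c) = 0 := by
  obtain ⟨c, hc⟩ := (ModuleCat.epi_iff_surjective (K.homologyπ i)).1 inferInstance t
  refine ⟨c, hc, ?_⟩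
  rw [← ConcreteCategory.comp_apply, K.iCycles_d]
  rfl

theorem exists_cycle (K : ChainComplex (ModuleCat.{0} ℤ) ℤ) {i j : ℤ} (h : j + 1 = i)
    (z : K.X i) (hz : K.d i j z = 0) : ∃ c : K.cycles i, K.iCycles i c = z := by
  have hn : (ComplexShape.down ℤ).next i = j := (ComplexShape.down ℤ).next_eq' h
  have hx : ((forget₂ (ModuleCat ℤ) Ab).map (K.d i j)) z = 0 := hz
  exact ⟨K.cyclesMk (C := ModuleCat ℤ) z j hn hx, K.i_cyclesMk (C := ModuleCat ℤ) z j hn hx⟩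

theorem homologyπ_eq_zero_iff (K : ChainComplex (ModuleCat.{0} ℤ) ℤ) {i j : ℤ} (h : j + 1 = i)
    (c : K.cycles j) :
    K.homologyπ j c = 0 ↔ ∃ z : K.X i, K.d i j z = K.iCycles j c := by
  have hp : (ComplexShape.down ℤ).prev j = i := (ComplexShape.down ℤ).prev_eq' h
  have hexact : (ShortComplex.mk (K.toCycles i j) (K.homologyπ j)
      (K.toCycles_comp_homologyπ i j)).Exact :=
    ShortComplex.exact_of_g_is_cokernel _ (K.homologyIsCokernel i j hp)
  rw [ShortComplex.moduleCat_exact_iff] at hexact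
  have hinj : Function.Injective (K.iCycles j) :=
    (ModuleCat.mono_iff_injective (K.iCycles j)).1 inferInstance
  have hto : ∀ z, K.iCycles j (K.toCycles i j z) = K.d i j z := fun z => by
    rw [← ConcreteCategory.comp_apply, K.toCycles_i]
  constructor
  · intro hc
    obtain ⟨z, hz⟩ := hexact c hc
    exact ⟨z, by rw [← hto]; exact congrArg _ hz⟩
  · rintro ⟨z, hz⟩
    rw [← hto] at hz
    rw [← hinj hz, ← ConcreteCategory.comp_apply, K.toCycles_comp_homologyπ]
    rfl

/-- A chain map that is bijective on homology classes in degree `j` induces an isomorphism. -/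
theorem homology_iso_of_chain_map (f : A ⟶ B) {i j k : ℤ} (hi : j + 1 = i) (hk : k + 1 = j)
    (inj : ∀ z : A.X j, A.d j k z = 0 → (∃ t : B.X i, B.d i j t = f.f j z) →
      ∃ z' : A.X i, A.d i j z' = z)
    (surj : ∀ t : B.X j, B.d j k t = 0 →
      ∃ (z : A.X j) (t' : B.X i), A.d j k z = 0 ∧ f.f j z = t + B.d i j t') :
    Nonempty (A.homology j ≅ B.homology j) := by
  have hnat : ∀ c, HomologicalComplex.homologyMap f j (A.homologyπ j c)
      = B.homologyπ j (HomologicalComplex.cyclesMap f j c) := fun c => by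
    rw [← ConcreteCategory.comp_apply, HomologicalComplex.homologyπ_naturality]
    rfl
  have hcyc : ∀ c, B.iCycles j (HomologicalComplex.cyclesMap f j c) = f.f j (A.iCycles j c) :=
    fun c => by
      rw [← ConcreteCategory.comp_apply, HomologicalComplex.cyclesMap_i]
      rfl
  have hinj : Mono (HomologicalComplex.homologyMap f j) := by
    rw [ModuleCat.mono_iff_injective, injective_iff_map_eq_zero]
    intro t ht
    obtain ⟨c, rfl, hc⟩ := exists_homologyπ A k t
    rw [hnat, homologyπ_eq_zero_iff B hi, hcyc] at ht
    rw [homologyπ_eq_zero_iff A hi]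
    exact inj _ hc ht
  have hsurj : Epi (HomologicalComplex.homologyMap f j) := by
    rw [ModuleCat.epi_iff_surjective]
    intro s
    obtain ⟨c, rfl, hc⟩ := exists_homologyπ B k s
    obtain ⟨z, t', hz, hzt⟩ := surj _ hc
    obtain ⟨c', rfl⟩ := exists_cycle A hk z hz
    refine ⟨A.homologyπ j c', ?_⟩
    rw [hnat, ← sub_eq_zero, ← map_sub, homologyπ_eq_zero_iff B hi]
    refine ⟨t', ?_⟩
    rw [map_sub, hcyc, hzt, add_sub_cancel_left]
  have := isIso_of_mono_of_epi (HomologicalComplex.homologyMap f j)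
  exact ⟨asIso (HomologicalComplex.homologyMap f j)⟩

open HomologicalComplex.homotopyCofiber in
/-- A criterion for the homology of `A` to be that of the cone of multiplication by `m` on `B`, in
terms of the two components `x`, `y` of a chain map from `A` to the cone. -/
theorem homology_iso_coneMul (m : ℤ) (x : ∀ i j : ℤ, j + 1 = i → (A.X i ⟶ B.X j))
    (y : ∀ i : ℤ, A.X i ⟶ B.X i)
    (hx : ∀ i j k (hij : j + 1 = i) (hjk : k + 1 = j),
      A.d i j ≫ x j k hjk = -(x i j hij ≫ B.d j k))
    (hy : ∀ i j (hij : j + 1 = i), A.d i j ≫ y j = m • x i j hij + y i ≫ B.d i j)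
    {i j k : ℤ} (hij : j + 1 = i) (hjk : k + 1 = j)
    -- The boundary of the cone is (b, c) ↦ (-∂b, mb + ∂c); only its second coordinate is used here.
    (inj : ∀ (z : A.X j) (b : B.X j) (c : B.X i), A.d j k z = 0 → y j z = m • b + B.d i j c →
      ∃ z' : A.X i, A.d i j z' = z)
    (surj : ∀ (b : B.X k) (c : B.X j), m • b + B.d j k c = 0 →
      ∃ (z : A.X j) (b' : B.X j) (c' : B.X i), A.d j k z = 0 ∧ x j k hjk z = b - B.d j k b' ∧
        y j z = c + (m • b' + B.d i j c')) :
    Nonempty (A.homology j ≅ (coneMul m B).homology j) := by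
  have rel : ∀ i : ℤ, (ComplexShape.down ℤ).Rel i (i - 1) := fun i => sub_add_cancel i 1
  let φ : B ⟶ B := m • 𝟙 B
  have hφ : ∀ i, φ.f i = m • 𝟙 (B.X i) := fun i => rfl
  let g : ∀ i, A.X i ⟶ X φ i := fun i =>
    x i (i - 1) (rel i) ≫ inlX φ (i - 1) i (rel i) + y i ≫ inrX φ i
  have hg1 : ∀ i j (h : j + 1 = i), g i ≫ fstX φ i j h = x i j h := by
    rintro i j h
    obtain rfl : j = i - 1 := by omega
    simp [g, inrX_fstX φ i (i - 1) h]
  have hg2 : ∀ i, g i ≫ sndX φ i = y i := fun i => by simp [g]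
  have hcomm : ∀ i j, j + 1 = i → g i ≫ d φ i j = A.d i j ≫ g j := by
    intro i j h
    apply ext_to_X φ j (j - 1) (rel j)
    · rw [Category.assoc, Category.assoc, d_fstX φ i j (j - 1) h (rel j), hg1 j _ (rel j),
        hx i j _ h (rel j), Preadditive.comp_neg, ← Category.assoc, hg1 i j h]
    · rw [Category.assoc, Category.assoc, d_sndX φ i j h, hg2, hy i j h, Preadditive.comp_add,
        ← Category.assoc, ← Category.assoc, hg1 i j h, hg2, hφ, Preadditive.comp_zsmul,
        Category.comp_id]
  let f : A ⟶ coneMul m B :=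
    { f := g
      comm' := fun i j h => hcomm i j h }
  -- Elements of the cone are compared through their two coordinates from here on.
  have elt : ∀ i j (h : j + 1 = i) (t t' : (X φ i : ModuleCat.{0} ℤ)), fstX φ i j h t = fstX φ i j h t' →
      sndX φ i t = sndX φ i t' → t = t' := by
    intro i j h t t' h1 h2
    have hid : fstX φ i j h ≫ inlX φ j i h + sndX φ i ≫ inrX φ i = 𝟙 (X φ i) := by
      apply ext_to_X φ i j h
      · rw [Preadditive.add_comp, Category.assoc, Category.assoc, inlX_fstX φ j i h,
          inrX_fstX φ i j h]
        simp
      · rw [Preadditive.add_comp, Category.assoc, Category.assoc, inlX_sndX φ j i h, inrX_sndX]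
        simp
    have key : ∀ s : (X φ i : ModuleCat.{0} ℤ), s = inlX φ j i h (fstX φ i j h s) + inrX φ i (sndX φ i s) := fun s => by
      have := congrArg (fun u => u.hom s) hid
      simpa using this.symm
    rw [key t, key t', h1, h2]
  have hd1 : ∀ i j k (hij : j + 1 = i) (hjk : k + 1 = j) (t : (X φ i : ModuleCat.{0} ℤ)),
      fstX φ j k hjk (d φ i j t) = -B.d j k (fstX φ i j hij t) := by
    intro i j k hij hjk t
    have := congrArg (fun u => u.hom t) (d_fstX φ i j k hij hjk)
    simpa using this
  have hd2 : ∀ i j (hij : j + 1 = i) (t : (X φ i : ModuleCat.{0} ℤ)),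
      sndX φ j (d φ i j t) = m • fstX φ i j hij t + B.d i j (sndX φ i t) := by
    intro i j hij t
    have := congrArg (fun u => u.hom t) (d_sndX φ i j hij)
    rw [hφ] at this
    simpa using this
  have hf1 : ∀ i j (h : j + 1 = i) (z : A.X i), fstX φ i j h (g i z) = x i j h z :=
    fun i j h z => congrArg (fun u => u.hom z) (hg1 i j h)
  have hf2 : ∀ i (z : A.X i), sndX φ i (g i z) = y i z :=
    fun i z => congrArg (fun u => u.hom z) (hg2 i)
  have ex : ∀ i j (h : j + 1 = i) (b : B.X j) (c : B.X i),
      ∃ t : (X φ i : ModuleCat.{0} ℤ), fstX φ i j h t = b ∧ sndX φ i t = c := by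
    intro i j h b c
    refine ⟨inlX φ j i h b + inrX φ i c, ?_, ?_⟩
    · have h1 : fstX φ i j h (inlX φ j i h b) = b :=
        congrArg (fun u => u.hom b) (inlX_fstX φ j i h)
      have h2 : fstX φ i j h (inrX φ i c) = 0 :=
        congrArg (fun u => u.hom c) (inrX_fstX φ i j h)
      rw [map_add, h1, h2, add_zero]
    · have h1 : sndX φ i (inlX φ j i h b) = 0 :=
        congrArg (fun u => u.hom b) (inlX_sndX φ j i h)
      have h2 : sndX φ i (inrX φ i c) = c := congrArg (fun u => u.hom c) (inrX_sndX φ i)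
      rw [map_add, h1, h2, zero_add]
  refine homology_iso_of_chain_map f hij hjk ?_ ?_
  · rintro z hz ⟨t, ht⟩
    exact inj z (fstX φ i j hij t) (sndX φ i t) hz ((hf2 j z).symm.trans
      ((congrArg (fun s : (X φ j : ModuleCat.{0} ℤ) => sndX φ j s) ht.symm).trans (hd2 i j hij t)))
  · intro t ht
    have h2 := hd2 j k hjk t
    rw [show d φ j k t = 0 from ht, map_zero] at h2
    obtain ⟨z, b', c', hz, hzx, hzy⟩ := surj _ _ h2.symm
    obtain ⟨t', rfl, rfl⟩ := ex i j hij b' c'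
    have key : ∀ (s : (X φ j : ModuleCat.{0} ℤ)) (s' : (X φ i : ModuleCat.{0} ℤ)),
        x j k hjk z = fstX φ j k hjk s - B.d j k (fstX φ i j hij s') →
        y j z = sndX φ j s + (m • fstX φ i j hij s' + B.d i j (sndX φ i s')) →
        g j z = s + d φ i j s' := by
      intro s s' h1 h2
      apply elt j k hjk
      · rw [hf1, map_add, hd1 i j k hij hjk, h1, sub_eq_add_neg]
      · rw [hf2, map_add, hd2 i j hij, h2]
    exact ⟨z, t', hz, key t t' hzx hzy⟩

end Homology

/-! ### Derivations of the exterior algebra, their divided squares, and contractions -/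

section Derivations

variable {R L : Type*} [CommRing R] [LieRing L] [LieAlgebra R L]

/-- One step of the recursion for `derExt`. -/
def derStep (φ : L →ₗ[R] L) : L →ₗ[R] (ExteriorAlgebra R L × ExteriorAlgebra R L) →ₗ[R]
    ExteriorAlgebra R L :=
  (wedgeLeft.comp φ).compl₂ (LinearMap.fst R _ _) + wedgeLeft.compl₂ (LinearMap.snd R _ _)

theorem derStep_apply (φ : L →ₗ[R] L) (y : L) (u v : ExteriorAlgebra R L) :
    derStep φ y (u, v) = ExteriorAlgebra.ι R (φ y) * u + ExteriorAlgebra.ι R y * v := rfl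

theorem derStep_derStep (φ : L →ₗ[R] L) (y : L) (u v : ExteriorAlgebra R L) :
    derStep φ y (ExteriorAlgebra.ι R y * u, derStep φ y (u, v))
      = (0 : QuadraticForm R L) y • v := by
  simp only [derStep_apply, mul_add, ι_mul_self_mul, ι_mul_ι_mul (φ y) y]
  simp

/-- The derivation of the exterior algebra that extends a linear endomorphism `φ`. -/
def derExt (φ : L →ₗ[R] L) : ExteriorAlgebra R L →ₗ[R] ExteriorAlgebra R L :=
  CliffordAlgebra.foldr' 0 (derStep φ) (derStep_derStep φ) 0

@[simp] theorem derExt_one (φ : L →ₗ[R] L) : derExt φ (1 : ExteriorAlgebra R L) = 0 := by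
  have h := CliffordAlgebra.foldr'_algebraMap (R := R) (Q := 0) (derStep φ) (derStep_derStep φ) 0 1
  rw [map_one, smul_zero] at h
  exact h

@[simp] theorem derExt_ι_mul (φ : L →ₗ[R] L) (y : L) (u : ExteriorAlgebra R L) :
    derExt φ (ExteriorAlgebra.ι R y * u)
      = ExteriorAlgebra.ι R (φ y) * u + ExteriorAlgebra.ι R y * derExt φ u :=
  CliffordAlgebra.foldr'_ι_mul (R := R) (Q := 0) (derStep φ) _ 0 y u

theorem derExt_ad (x : L) : derExt (LieAlgebra.ad R L x) = adExt x := by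
  refine LinearMap.ext fun u => ?_
  induction u using ext_induction with
  | one => simp
  | add u v hu hv => simp only [map_add, hu, hv]
  | smul r u hu => simp only [map_smul, hu]
  | ι_mul z u hu => simp [hu]

/-- One step of the recursion for `divExt`. -/
def divStep (φ : L →ₗ[R] L) : L →ₗ[R] (ExteriorAlgebra R L × ExteriorAlgebra R L) →ₗ[R]
    ExteriorAlgebra R L :=
  (wedgeLeft.comp φ).compl₂ ((derExt φ).comp (LinearMap.fst R _ _)) +
    wedgeLeft.compl₂ (LinearMap.snd R _ _)

theorem divStep_apply (φ : L →ₗ[R] L) (y : L) (u v : ExteriorAlgebra R L) :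
    divStep φ y (u, v) = ExteriorAlgebra.ι R (φ y) * derExt φ u + ExteriorAlgebra.ι R y * v := rfl

/-- The term with φ(y) twice vanishes and the two mixed terms cancel by anticommutation. No
condition φ² = 0 is needed here; it enters only in `derExt_derExt_eq`. -/
theorem divStep_divStep (φ : L →ₗ[R] L) (y : L) (u v : ExteriorAlgebra R L) :
    divStep φ y (ExteriorAlgebra.ι R y * u, divStep φ y (u, v))
      = (0 : QuadraticForm R L) y • v := by
  simp only [divStep_apply, derExt_ι_mul, mul_add, ι_mul_self_mul, ι_mul_ι_mul (φ y) y]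
  simp

/-- If `φ ^ 2 = 0`, this is the divided square of the derivation `derExt φ`. -/
def divExt (φ : L →ₗ[R] L) : ExteriorAlgebra R L →ₗ[R] ExteriorAlgebra R L :=
  CliffordAlgebra.foldr' 0 (divStep φ) (divStep_divStep φ) 0

@[simp] theorem divExt_one (φ : L →ₗ[R] L) : divExt φ (1 : ExteriorAlgebra R L) = 0 := by
  have h := CliffordAlgebra.foldr'_algebraMap (R := R) (Q := 0) (divStep φ) (divStep_divStep φ) 0 1
  rw [map_one, smul_zero] at h
  exact h

@[simp] theorem divExt_ι_mul (φ : L →ₗ[R] L) (y : L) (u : ExteriorAlgebra R L) :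
    divExt φ (ExteriorAlgebra.ι R y * u)
      = ExteriorAlgebra.ι R (φ y) * derExt φ u + ExteriorAlgebra.ι R y * divExt φ u :=
  CliffordAlgebra.foldr'_ι_mul (R := R) (Q := 0) (divStep φ) _ 0 y u

/-- Contraction of the exterior algebra with a linear form. -/
def contract (d : Module.Dual R L) : ExteriorAlgebra R L →ₗ[R] ExteriorAlgebra R L :=
  CliffordAlgebra.contractLeft (Q := 0) d

@[simp] theorem contract_one (d : Module.Dual R L) : contract d (1 : ExteriorAlgebra R L) = 0 :=
  CliffordAlgebra.contractLeft_one (Q := 0) d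

@[simp] theorem contract_ι_mul (d : Module.Dual R L) (x : L) (u : ExteriorAlgebra R L) :
    contract d (ExteriorAlgebra.ι R x * u) = d x • u - ExteriorAlgebra.ι R x * contract d u :=
  CliffordAlgebra.contractLeft_ι_mul (Q := 0) d x u

end Derivations

/-! ### Wedges of matrix units -/

section Wedges

attribute [local instance 100] LieRing.ofAssociativeRing

variable {n : ℕ}

theorem wedge_nil : wedge ([] : List (Pos n)) = 1 := by simp [wedge, wedgeList]

theorem wedge_append (l l' : List (Pos n)) : wedge (l ++ l') = wedge l * wedge l' := by
  simp [wedge, wedgeList]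

/-- The sign need not be tracked: all spans in use are closed under negation. -/
theorem wedge_perm {l l' : List (Pos n)} (h : l.Perm l') :
    wedge l = wedge l' ∨ wedge l = -wedge l' := by
  induction h with
  | nil => exact Or.inl rfl
  | cons x _ ih =>
    rw [wedge_cons, wedge_cons]
    rcases ih with h | h <;> simp [h]
  | swap x y l =>
    right
    simp only [wedge_cons]
    exact ι_mul_ι_mul _ _ _
  | trans _ _ h1 h2 =>
    rcases h1 with h1 | h1 <;> rcases h2 with h2 | h2 <;> simp [h1, h2]

theorem wedge_eq_zero_of_not_nodup {l : List (Pos n)} (h : ¬l.Nodup) : wedge l = 0 := by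
  induction l with
  | nil => exact absurd List.nodup_nil h
  | cons x l ih =>
    by_cases hx : x ∈ l
    · have hz : wedge (x :: x :: l.erase x) = 0 := by
        simp only [wedge_cons]
        exact ι_mul_self_mul _ _
      rcases wedge_perm ((List.perm_cons_erase hx).cons x) with h | h <;> simp [h, hz]
    · rw [wedge_cons, ih fun hl => h (List.nodup_cons.2 ⟨hx, hl⟩), mul_zero]

theorem weight_perm {l l' : List (Pos n)} (h : l.Perm l') : weight l = weight l' := by
  funext i
  simp only [weight, h.countP_eq]

theorem modWeight_perm {l l' : List (Pos n)} (h : l.Perm l') : modWeight l = modWeight l' := by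
  funext i
  simp only [modWeight, weight_perm h]

theorem modWeight_cons (s : Pos n) (l : List (Pos n)) :
    modWeight (s :: l) = modWeight l - weight [s] := by
  funext i
  simp only [modWeight, weight_cons s l, Pi.sub_apply]
  ring

/-- The matrix entry at a position, as a linear form. -/
def entry (s : Pos n) : Module.Dual ℤ (nil n) where
  toFun A := A.1 s.1.1 s.1.2
  map_add' _ _ := rfl
  map_smul' _ _ := rfl

theorem entry_e (s t : Pos n) : entry s (e t) = if s = t then 1 else 0 := by
  change Matrix.single t.1.1 t.1.2 (1 : ℤ) s.1.1 s.1.2 = _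
  rw [Matrix.single_apply]
  refine if_congr ?_ rfl rfl
  rw [Subtype.ext_iff, Prod.ext_iff, eq_comm, @eq_comm _ t.1.2]

/-- The linear map on `nil n` with given values on the matrix units. -/
def unitsLift {M : Type*} [AddCommGroup M] (f : Pos n → M) : nil n →ₗ[ℤ] M :=
  ∑ s, (entry s).smulRight (f s)

@[simp] theorem unitsLift_e {M : Type*} [AddCommGroup M] (f : Pos n → M) (s : Pos n) :
    unitsLift f (e s) = f s := by
  simp [unitsLift, entry_e]

instance : Module.Free ℤ (nil n) :=
  inferInstanceAs (Module.Free ℤ (nil n).toSubmodule)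

open Classical in
instance : Module.IsTorsionFree ℤ (ExteriorAlgebra ℤ (nil n)) := by
  let b := Module.Free.chooseBasis ℤ (nil n)
  let : LinearOrder (Module.Free.ChooseBasisIndex ℤ (nil n)) := linearOrderOfSTO WellOrderingRel
  have : Module.Free ℤ (ExteriorAlgebra ℤ (nil n)) := Module.Free.of_basis b.ExteriorAlgebra
  infer_instance

/-- Identities for divided squares are proved by doubling them, which turns the divided square into
a composite of derivations. -/
theorem two_smul_cancel {u v : ExteriorAlgebra ℤ (nil n)} (h : (2 : ℤ) • u = (2 : ℤ) • v) :
    u = v :=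
  smul_right_injective _ two_ne_zero h

end Wedges

/-! ### Wedges avoiding a fixed matrix unit, and operators on their span -/

section Avoiding

attribute [local instance 100] LieRing.ofAssociativeRing

variable {n : ℕ}

/-- The span of the wedges of `k` matrix units different from `e r` that have modified weight
`w`. -/
def freeSub (r : Pos n) (w : Fin n → ℤ) (k : ℤ) : Submodule ℤ (ExteriorAlgebra ℤ (nil n)) :=
  Submodule.span ℤ
    {u | ∃ l : List (Pos n), (l.length : ℤ) = k ∧ modWeight l = w ∧ r ∉ l ∧ u = wedge l}

theorem wedge_mem_freeSub {r : Pos n} {l : List (Pos n)} (h : r ∉ l) :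
    wedge l ∈ freeSub r (modWeight l) l.length :=
  Submodule.subset_span ⟨l, rfl, rfl, h, rfl⟩

theorem freeSub_le (r : Pos n) (w : Fin n → ℤ) (k : ℤ) : freeSub r w k ≤ bracketSub w k :=
  Submodule.span_mono fun _ ⟨l, h1, h2, _, h3⟩ => ⟨l, h1, h2, h3⟩

/-- A property of linear maps holds on `freeSub` if it holds on wedges. -/
theorem map_freeSub_mem {r : Pos n} {w : Fin n → ℤ} {k : ℤ} {M : Type*} [AddCommGroup M]
    (f : ExteriorAlgebra ℤ (nil n) →ₗ[ℤ] M) (P : Submodule ℤ M)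
    (h : ∀ l : List (Pos n), (l.length : ℤ) = k → modWeight l = w → r ∉ l → f (wedge l) ∈ P)
    {u : ExteriorAlgebra ℤ (nil n)} (hu : u ∈ freeSub r w k) : f u ∈ P := by
  have : freeSub r w k ≤ P.comap f := by
    refine Submodule.span_le.2 ?_
    rintro _ ⟨l, h1, h2, h3, rfl⟩
    exact h l h1 h2 h3
  exact this hu

theorem map_bracketSub_mem {w : Fin n → ℤ} {k : ℤ} {M : Type*} [AddCommGroup M]
    (f : ExteriorAlgebra ℤ (nil n) →ₗ[ℤ] M) (P : Submodule ℤ M)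
    (h : ∀ l : List (Pos n), (l.length : ℤ) = k → modWeight l = w → f (wedge l) ∈ P)
    {u : ExteriorAlgebra ℤ (nil n)} (hu : u ∈ bracketSub w k) : f u ∈ P := by
  have : bracketSub w k ≤ P.comap f := by
    refine Submodule.span_le.2 ?_
    rintro _ ⟨l, h1, h2, rfl⟩
    exact h l h1 h2
  exact this hu

theorem ι_mul_mem_freeSub {r s : Pos n} (hs : s ≠ r) {w : Fin n → ℤ} {k : ℤ}
    {u : ExteriorAlgebra ℤ (nil n)} (hu : u ∈ freeSub r w k) :
    ExteriorAlgebra.ι ℤ (e s) * u ∈ freeSub r (w - weight [s]) (k + 1) := by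
  refine map_freeSub_mem (LinearMap.mulLeft ℤ (ExteriorAlgebra.ι ℤ (e s))) _ ?_ hu
  rintro l rfl rfl hl
  rw [LinearMap.mulLeft_apply, ← wedge_cons, ← modWeight_cons]
  exact Submodule.subset_span ⟨s :: l, by simp, rfl, by simp [hl, hs.symm], rfl⟩

/-- The endomorphism `φ` of `nil n` maps the matrix units other than `e r` to such matrix units,
up to sign, or to zero, and increases the weight by `δ`. -/
def ShiftsUnits (r : Pos n) (δ : Fin n → ℤ) (φ : nil n →ₗ[ℤ] nil n) : Prop :=
  ∀ s, s ≠ r → φ (e s) = 0 ∨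
    ∃ s', s' ≠ r ∧ weight [s'] = weight [s] + δ ∧ (φ (e s) = e s' ∨ φ (e s) = -e s')

theorem ShiftsUnits.ι_mul_mem {r : Pos n} {δ : Fin n → ℤ} {φ : nil n →ₗ[ℤ] nil n}
    (hφ : ShiftsUnits r δ φ) {s : Pos n} (hs : s ≠ r) {w : Fin n → ℤ} {k : ℤ}
    {u : ExteriorAlgebra ℤ (nil n)} (hu : u ∈ freeSub r w k) :
    ExteriorAlgebra.ι ℤ (φ (e s)) * u ∈ freeSub r (w - weight [s] - δ) (k + 1) := by
  rcases hφ s hs with h | ⟨s', hs', hw, h | h⟩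
  · simp [h]
  · rw [h, sub_sub, ← hw]
    exact ι_mul_mem_freeSub hs' hu
  · rw [h, sub_sub, ← hw, map_neg, neg_mul]
    exact neg_mem (ι_mul_mem_freeSub hs' hu)

theorem ShiftsUnits.derExt_wedge_mem {r : Pos n} {δ : Fin n → ℤ} {φ : nil n →ₗ[ℤ] nil n}
    (hφ : ShiftsUnits r δ φ) {l : List (Pos n)} (hl : r ∉ l) :
    derExt φ (wedge l) ∈ freeSub r (modWeight l - δ) l.length := by
  induction l with
  | nil => simp [wedge_nil]
  | cons s l ih =>
    rw [List.mem_cons, not_or] at hl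
    rw [wedge_cons, derExt_ι_mul, modWeight_cons, List.length_cons, Nat.cast_add, Nat.cast_one]
    refine add_mem (hφ.ι_mul_mem (Ne.symm hl.1) (wedge_mem_freeSub hl.2)) ?_
    rw [sub_right_comm]
    exact ι_mul_mem_freeSub (Ne.symm hl.1) (ih hl.2)

theorem ShiftsUnits.derExt_mem {r : Pos n} {δ : Fin n → ℤ} {φ : nil n →ₗ[ℤ] nil n}
    (hφ : ShiftsUnits r δ φ) {w : Fin n → ℤ} {k : ℤ} {u : ExteriorAlgebra ℤ (nil n)}
    (hu : u ∈ freeSub r w k) : derExt φ u ∈ freeSub r (w - δ) k := by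
  refine map_freeSub_mem _ _ ?_ hu
  rintro l rfl rfl hl
  exact hφ.derExt_wedge_mem hl

theorem ShiftsUnits.divExt_mem {r : Pos n} {δ : Fin n → ℤ} {φ : nil n →ₗ[ℤ] nil n}
    (hφ : ShiftsUnits r δ φ) {w : Fin n → ℤ} {k : ℤ} {u : ExteriorAlgebra ℤ (nil n)}
    (hu : u ∈ freeSub r w k) : divExt φ u ∈ freeSub r (w - δ - δ) k := by
  refine map_freeSub_mem _ _ ?_ hu
  rintro l rfl rfl hl
  clear hu
  induction l with
  | nil => simp [wedge_nil]
  | cons s l ih =>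
    rw [List.mem_cons, not_or] at hl
    rw [wedge_cons, divExt_ι_mul, modWeight_cons, List.length_cons, Nat.cast_add, Nat.cast_one]
    have h1 := hφ.ι_mul_mem (Ne.symm hl.1) (hφ.derExt_wedge_mem hl.2)
    have h2 := ι_mul_mem_freeSub (Ne.symm hl.1) (ih hl.2)
    refine add_mem ?_ ?_
    · convert h1 using 2
      abel
    · convert h2 using 2
      abel

/-- In the square of the derivation, terms with φ applied twice to the same factor vanish, and each
pair of factors is hit in two orders. -/
theorem derExt_derExt_eq {r : Pos n} {φ : nil n →ₗ[ℤ] nil n}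
    (hφ : ∀ s, s ≠ r → φ (φ (e s)) = 0) {w : Fin n → ℤ} {k : ℤ} {u : ExteriorAlgebra ℤ (nil n)}
    (hu : u ∈ freeSub r w k) : derExt φ (derExt φ u) = (2 : ℤ) • divExt φ u := by
  rw [← sub_eq_zero, ← Submodule.mem_bot ℤ]
  refine map_freeSub_mem (derExt φ ∘ₗ derExt φ - (2 : ℤ) • divExt φ) _ ?_ hu
  rintro l - - hl
  simp only [LinearMap.sub_apply, LinearMap.comp_apply, LinearMap.smul_apply, Submodule.mem_bot,
    sub_eq_zero]
  induction l with
  | nil => simp [wedge_nil]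
  | cons s l ih =>
    rw [List.mem_cons, not_or] at hl
    simp only [wedge_cons, derExt_ι_mul, divExt_ι_mul, map_add, hφ s (Ne.symm hl.1), map_zero,
      ih hl.2, zero_mul, zero_add, mul_smul_comm, smul_add]
    rw [two_smul ℤ, two_smul ℤ]
    abel

/-- A commutator of derivations is a derivation. Here it is diagonal on the matrix units, so a wedge
is an eigenvector whose eigenvalue is the sum over its factors, and this sum depends on `w` only. -/
theorem derExt_commutator {r : Pos n} {φ ψ : nil n →ₗ[ℤ] nil n} {a b : Fin n}
    (h : ∀ s, s ≠ r → φ (ψ (e s)) - ψ (φ (e s)) = (weight [s] b - weight [s] a) • e s)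
    {w : Fin n → ℤ} {k : ℤ} {u : ExteriorAlgebra ℤ (nil n)} (hu : u ∈ freeSub r w k) :
    derExt φ (derExt ψ u) = derExt ψ (derExt φ u)
      + (((b : ℕ) : ℤ) - ((a : ℕ) : ℤ) - (w b - w a)) • u := by
  rw [← sub_eq_zero, ← Submodule.mem_bot ℤ]
  refine map_freeSub_mem (derExt φ ∘ₗ derExt ψ - (derExt ψ ∘ₗ derExt φ
    + (((b : ℕ) : ℤ) - ((a : ℕ) : ℤ) - (w b - w a)) • LinearMap.id)) _ ?_ hu
  rintro l - rfl hl
  have hw : ((b : ℕ) : ℤ) - ((a : ℕ) : ℤ) - (modWeight l b - modWeight l a)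
      = weight l b - weight l a := by
    simp only [modWeight]
    ring
  simp only [LinearMap.sub_apply, LinearMap.comp_apply, LinearMap.smul_apply, LinearMap.add_apply,
    LinearMap.id_apply, Submodule.mem_bot, sub_eq_zero, hw]
  clear hw hu
  induction l with
  | nil => simp [wedge_nil, weight]
  | cons s l ih =>
    rw [List.mem_cons, not_or] at hl
    have hc : weight (s :: l) b - weight (s :: l) a
        = (weight [s] b - weight [s] a) + (weight l b - weight l a) := by
      rw [weight_cons s l, weight_cons s l]
      ring
    have hs := sub_eq_iff_eq_add.1 (h s (Ne.symm hl.1))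
    rw [hc]
    generalize weight [s] b - weight [s] a = c at hs
    simp only [wedge_cons, derExt_ι_mul, map_add, ih hl.2, hs, map_smul, add_mul, mul_add,
      smul_mul_assoc, mul_smul_comm, add_smul]
    abel

theorem contract_freeSub {r : Pos n} {w : Fin n → ℤ} {k : ℤ} {u : ExteriorAlgebra ℤ (nil n)}
    (hu : u ∈ freeSub r w k) : contract (entry r) u = 0 := by
  rw [← Submodule.mem_bot ℤ]
  refine map_freeSub_mem _ _ ?_ hu
  rintro l - - hl
  clear hu
  induction l with
  | nil => simp [wedge_nil]
  | cons s l ih =>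
    rw [List.mem_cons, not_or] at hl
    have := (Submodule.mem_bot ℤ).1 (ih hl.2)
    simp [wedge_cons, entry_e, hl.1, this]

theorem contract_ι_mul_freeSub {r : Pos n} {w : Fin n → ℤ} {k : ℤ}
    {u : ExteriorAlgebra ℤ (nil n)} (hu : u ∈ freeSub r w k) :
    contract (entry r) (ExteriorAlgebra.ι ℤ (e r) * u) = u := by
  simp [entry_e, contract_freeSub hu]

/-- This gives the two coordinates of the splitting by `e r`. If `r` occurs, it is moved to the
front up to sign and the second coordinate vanishes; otherwise the contraction vanishes. -/
theorem contract_wedge (r : Pos n) (l : List (Pos n)) :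
    contract (entry r) (wedge l) ∈ freeSub r (modWeight l + weight [r]) (l.length - 1) ∧
    wedge l - ExteriorAlgebra.ι ℤ (e r) * contract (entry r) (wedge l)
      ∈ freeSub r (modWeight l) l.length := by
  by_cases hl : l.Nodup
  · by_cases hr : r ∈ l
    · have hp := List.perm_cons_erase hr
      have hr' : r ∉ l.erase r := (List.nodup_cons.1 (hp.nodup_iff.1 hl)).1
      have hm := wedge_mem_freeSub hr'
      have hz : wedge (r :: l.erase r) - ExteriorAlgebra.ι ℤ (e r) *
          contract (entry r) (wedge (r :: l.erase r)) = 0 := by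
        rw [wedge_cons, contract_ι_mul_freeSub hm, sub_self]
      have hm' : contract (entry r) (wedge (r :: l.erase r))
          ∈ freeSub r (modWeight l + weight [r]) (l.length - 1) := by
        rw [wedge_cons, contract_ι_mul_freeSub hm, modWeight_perm hp, modWeight_cons,
          sub_add_cancel, hp.length_eq]
        simpa using hm
      rcases wedge_perm hp with h | h <;> rw [h]
      · exact ⟨hm', hz ▸ zero_mem _⟩
      · rw [map_neg, mul_neg, ← neg_sub', hz, neg_zero]
        exact ⟨neg_mem hm', zero_mem _⟩
    · rw [contract_freeSub (wedge_mem_freeSub hr), mul_zero, sub_zero]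
      exact ⟨zero_mem _, wedge_mem_freeSub hr⟩
  · simp [wedge_eq_zero_of_not_nodup hl]

theorem contract_mem {r : Pos n} {w : Fin n → ℤ} {k : ℤ} {u : ExteriorAlgebra ℤ (nil n)}
    (hu : u ∈ bracketSub w k) :
    contract (entry r) u ∈ freeSub r (w + weight [r]) (k - 1) := by
  refine map_bracketSub_mem _ _ ?_ hu
  rintro l rfl rfl
  exact (contract_wedge r l).1

theorem sub_contract_mem {r : Pos n} {w : Fin n → ℤ} {k : ℤ} {u : ExteriorAlgebra ℤ (nil n)}
    (hu : u ∈ bracketSub w k) :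
    u - ExteriorAlgebra.ι ℤ (e r) * contract (entry r) u ∈ freeSub r w k := by
  refine map_bracketSub_mem (LinearMap.id - LinearMap.mulLeft ℤ (ExteriorAlgebra.ι ℤ (e r)) ∘ₗ
    contract (entry r)) _ ?_ hu
  rintro l rfl rfl
  exact (contract_wedge r l).2

/-! ### The raising and lowering operators of an edge between neighbours -/

theorem lie_e_of_eq {p q : Pos n} (h : p.1.2 = q.1.1) :
    ⁅e p, e q⁆ = e ⟨(p.1.1, q.1.2), lt_trans p.2 (lt_of_eq_of_lt h q.2)⟩ := by
  rw [lie_e, dif_pos h]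

theorem lie_e_of_eq' {p q : Pos n} (h : p.1.1 = q.1.2) :
    ⁅e p, e q⁆ = -e ⟨(q.1.1, p.1.2), lt_trans q.2 (lt_of_eq_of_lt h.symm p.2)⟩ := by
  have h' : p.1.2 ≠ q.1.1 := (q.2.trans (h.symm.trans_lt p.2)).ne'
  rw [lie_e, dif_neg h', dif_pos h]

theorem lie_e_of_ne {p q : Pos n} (h : p.1.2 ≠ q.1.1) (h' : p.1.1 ≠ q.1.2) : ⁅e p, e q⁆ = 0 := by
  rw [lie_e, dif_neg h, dif_neg h']

theorem weight_singleton (s : Pos n) (i : Fin n) :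
    weight [s] i = (if s.1.2 = i then 1 else 0) - (if s.1.1 = i then 1 else 0) := by
  simp [weight, List.countP_cons]

/-- A bracket of matrix units is never a matrix unit between neighbours. -/
theorem shiftsUnits_ad {r : Pos n} (hr : (r.1.2 : ℕ) = r.1.1 + 1) (s : Pos n) :
    ShiftsUnits r (weight [s]) (LieAlgebra.ad ℤ (nil n) (e s)) := by
  intro t _
  rw [LieAlgebra.ad_apply]
  have hs := s.2
  have ht := t.2
  rw [Fin.lt_def] at hs ht
  by_cases h : s.1.2 = t.1.1
  · refine Or.inr ⟨_, ?_, ?_, Or.inl (lie_e_of_eq h)⟩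
    · rintro rfl
      dsimp only at hr
      rw [Fin.ext_iff] at h
      omega
    · funext i
      simp only [weight_singleton, Pi.add_apply, h]
      ring
  by_cases h' : s.1.1 = t.1.2
  · refine Or.inr ⟨_, ?_, ?_, Or.inr (lie_e_of_eq' h')⟩
    · rintro rfl
      dsimp only at hr
      rw [Fin.ext_iff] at h'
      omega
    · funext i
      simp only [weight_singleton, Pi.add_apply, h']
      ring
  exact Or.inl (lie_e_of_ne h h')

theorem ad_ad_e (r s : Pos n) : ⁅e r, ⁅e r, e s⁆⁆ = 0 := by
  have hs := s.2
  have hr := r.2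
  by_cases h : r.1.2 = s.1.1
  · rw [lie_e_of_eq h, lie_e_of_ne]
    · exact hr.ne'
    · exact (hr.trans (h.trans_lt hs)).ne
  by_cases h' : r.1.1 = s.1.2
  · rw [lie_e_of_eq' h', lie_neg, lie_e_of_ne, neg_zero]
    · exact (hs.trans (h'.symm.trans_lt hr)).ne'
    · exact hr.ne
  rw [lie_e_of_ne h h', lie_zero]

/-- The action of the transpose of `e r` on the matrix units. -/
def lowerUnit (r s : Pos n) : nil n :=
  if h : s.1.1 = r.1.1 ∧ r.1.2 < s.1.2 then e ⟨(r.1.2, s.1.2), h.2⟩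
  else if h : s.1.2 = r.1.2 ∧ s.1.1 < r.1.1 then -e ⟨(s.1.1, r.1.1), h.2⟩ else 0

/-- The action of the transpose of `e r` on `nil n`, followed by the projection to `nil n`. -/
def lower (r : Pos n) : nil n →ₗ[ℤ] nil n := unitsLift (lowerUnit r)

theorem lower_row {r s : Pos n} (h : s.1.1 = r.1.1) (h' : r.1.2 < s.1.2) :
    lower r (e s) = e ⟨(r.1.2, s.1.2), h'⟩ := by
  rw [lower, unitsLift_e, lowerUnit, dif_pos ⟨h, h'⟩]

theorem lower_col {r s : Pos n} (h : s.1.2 = r.1.2) (h' : s.1.1 < r.1.1) :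
    lower r (e s) = -e ⟨(s.1.1, r.1.1), h'⟩ := by
  rw [lower, unitsLift_e, lowerUnit, dif_neg fun h'' => h''.2.ne h.symm, dif_pos ⟨h, h'⟩]

theorem lower_of_not {r s : Pos n} (h : ¬(s.1.1 = r.1.1 ∧ r.1.2 < s.1.2))
    (h' : ¬(s.1.2 = r.1.2 ∧ s.1.1 < r.1.1)) : lower r (e s) = 0 := by
  rw [lower, unitsLift_e, lowerUnit, dif_neg h, dif_neg h']

theorem shiftsUnits_lower (r : Pos n) : ShiftsUnits r (-weight [r]) (lower r) := by
  intro t _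
  by_cases h : t.1.1 = r.1.1 ∧ r.1.2 < t.1.2
  · refine Or.inr ⟨_, ?_, ?_, Or.inl (lower_row h.1 h.2)⟩
    · intro hr
      exact r.2.ne' (congrArg (fun s : Pos n => s.1.1) hr)
    · funext i
      simp only [weight_singleton, Pi.add_apply, Pi.neg_apply, h.1]
      ring
  by_cases h' : t.1.2 = r.1.2 ∧ t.1.1 < r.1.1
  · refine Or.inr ⟨_, ?_, ?_, Or.inr (lower_col h'.1 h'.2)⟩
    · intro hr
      exact r.2.ne (congrArg (fun s : Pos n => s.1.2) hr)
    · funext i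
      simp only [weight_singleton, Pi.add_apply, Pi.neg_apply, h'.1]
      ring
  exact Or.inl (lower_of_not h h')

theorem lower_lower_e (r s : Pos n) : lower r (lower r (e s)) = 0 := by
  by_cases h : s.1.1 = r.1.1 ∧ r.1.2 < s.1.2
  · rw [lower_row h.1 h.2]
    exact lower_of_not (fun h' => r.2.ne' h'.1) fun h' => h.2.ne h'.1.symm
  by_cases h' : s.1.2 = r.1.2 ∧ s.1.1 < r.1.1
  · rw [lower_col h'.1 h'.2, map_neg, neg_eq_zero]
    exact lower_of_not (fun h => h'.2.ne h.1) fun h => r.2.ne h.1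
  rw [lower_of_not h h', map_zero]

/-- The relation [E, F] = H of sl₂. It fails on `e r` itself, whose bracket with its transpose is
diagonal and is lost in the projection to `nil n`; this is why the operators are studied on wedges
avoiding `e r`. Adjacency ensures that any other unit in row p lies to the right of column q, and
any other unit in column q lies above row p, so that `lower` keeps it. -/
theorem ad_lower_commutator {r : Pos n} (hr : (r.1.2 : ℕ) = r.1.1 + 1) {s : Pos n} (hs : s ≠ r) :
    LieAlgebra.ad ℤ (nil n) (e r) (lower r (e s)) - lower r (LieAlgebra.ad ℤ (nil n) (e r) (e s))
      = (weight [s] r.1.2 - weight [s] r.1.1) • e s := by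
  obtain ⟨⟨p, q⟩, hpq⟩ := r
  obtain ⟨⟨a, b⟩, hab⟩ := s
  simp only [ne_eq, Subtype.mk.injEq, Prod.mk.injEq, not_and] at hs hr
  have hpq' : (p : ℕ) < q := hpq
  have hab' : (a : ℕ) < b := hab
  simp only [LieAlgebra.ad_apply, weight_singleton]
  by_cases hap : a = p
  · subst hap
    have hqb : q < b := by
      have := mt Fin.ext (hs rfl)
      rw [Fin.lt_def]
      omega
    have h1 : lower ⟨(a, q), hpq⟩ (e ⟨(a, b), hab⟩) = e ⟨(q, b), hqb⟩ :=
      lower_row (r := ⟨(a, q), hpq⟩) (s := ⟨(a, b), hab⟩) rfl hqb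
    rw [h1, lie_e_of_eq rfl, lie_e_of_ne hpq.ne' hab.ne, map_zero]
    simp [hqb.ne', hab.ne', hpq.ne]
  by_cases hbq : b = q
  · subst hbq
    have hap' : a < p := by
      have := mt Fin.ext hap
      rw [Fin.lt_def]
      omega
    have h1 : lower ⟨(p, b), hpq⟩ (e ⟨(a, b), hab⟩) = -e ⟨(a, p), hap'⟩ :=
      lower_col (r := ⟨(p, b), hpq⟩) (s := ⟨(a, b), hab⟩) rfl hap'
    rw [h1, lie_neg, lie_e_of_eq' rfl, lie_e_of_ne hab.ne' hpq.ne, map_zero]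
    simp [hap, hpq.ne', hab.ne]
  have h0 : lower ⟨(p, q), hpq⟩ (e ⟨(a, b), hab⟩) = 0 :=
    lower_of_not (fun h => hap h.1) (fun h => hbq h.1)
  rw [h0, lie_zero]
  by_cases haq : a = q
  · subst haq
    have h1 : lower ⟨(p, a), hpq⟩ (e ⟨(p, b), hpq.trans hab⟩) = e ⟨(a, b), hab⟩ :=
      lower_row (r := ⟨(p, a), hpq⟩) (s := ⟨(p, b), hpq.trans hab⟩) rfl hab
    rw [lie_e_of_eq rfl, h1]
    simp [hbq, hap, (hpq.trans hab).ne']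
  by_cases hbp : b = p
  · subst hbp
    have h1 : lower ⟨(b, q), hpq⟩ (e ⟨(a, q), hab.trans hpq⟩) = -e ⟨(a, b), hab⟩ :=
      lower_col (r := ⟨(b, q), hpq⟩) (s := ⟨(a, q), hab.trans hpq⟩) rfl hab
    rw [lie_e_of_eq' rfl, map_neg, h1]
    simp [haq, hbq, hap]
  rw [lie_e_of_ne (Ne.symm haq) (Ne.symm hbp)]
  simp [haq, hbq, hap, hbp]

/-- Brackets never produce `e r`, by `shiftsUnits_ad`. -/
theorem boundary_mem_freeSub {r : Pos n} (hr : (r.1.2 : ℕ) = r.1.1 + 1) {w : Fin n → ℤ} {k : ℤ}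
    {u : ExteriorAlgebra ℤ (nil n)} (hu : u ∈ freeSub r w k) :
    boundary ℤ (nil n) u ∈ freeSub r w (k - 1) := by
  refine map_freeSub_mem _ _ ?_ hu
  rintro l rfl rfl hl
  clear hu
  induction l with
  | nil => simp [wedge_nil]
  | cons s l ih =>
    rw [List.mem_cons, not_or] at hl
    rw [wedge_cons, boundary_ι_mul, modWeight_cons, List.length_cons, Nat.cast_add, Nat.cast_one,
      add_sub_cancel_right, ← derExt_ad]
    refine neg_mem (add_mem ((shiftsUnits_ad hr s).derExt_wedge_mem hl.2) ?_)
    convert ι_mul_mem_freeSub (Ne.symm hl.1) (ih hl.2) using 2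
    ring

end Avoiding

/-! ### The sl₂ relations on the string of weights through w -/

section Raising

attribute [local instance 100] LieRing.ofAssociativeRing

variable {n : ℕ}

/-- The positions `(t, b)` with `t < p`. -/
def colList (p b : Fin n) (h : p ≤ b) : List (Pos n) :=
  (List.finRange (p : ℕ)).map fun t : Fin (p : ℕ) =>
    ⟨(⟨t, t.2.trans p.2⟩, b), lt_of_lt_of_le (Fin.lt_def.2 t.2) h⟩

theorem length_colList (p b : Fin n) (h : p ≤ b) : (colList p b h).length = p := by
  simp [colList]

theorem mem_colList {p b : Fin n} {h : p ≤ b} {s : Pos n} :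
    s ∈ colList p b h ↔ s.1.2 = b ∧ s.1.1 < p := by
  simp only [colList, List.mem_map, List.mem_finRange, true_and]
  constructor
  · rintro ⟨t, rfl⟩
    exact ⟨rfl, t.2⟩
  · rintro ⟨h1, h2⟩
    exact ⟨⟨s.1.1, h2⟩, Subtype.ext (Prod.ext rfl h1.symm)⟩

theorem nodup_colList (p b : Fin n) (h : p ≤ b) : (colList p b h).Nodup := by
  refine List.Nodup.map ?_ (List.nodup_finRange _)
  intro s t hst
  have := congrArg (fun x : Pos n => (x.1.1 : ℕ)) hst
  exact Fin.ext this

theorem filter_subperm_colList {p b : Fin n} (h : p ≤ b) {l : List (Pos n)} (hl : l.Nodup)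
    (hlp : ∀ s ∈ l, s.1.2 = b → s.1.1 < p) :
    (l.filter fun s => s.1.2 = b).Subperm (colList p b h) := by
  refine (hl.filter _).subperm fun s hs => ?_
  rw [List.mem_filter, decide_eq_true_eq] at hs
  exact mem_colList.2 ⟨hs.2, hlp s hs.1 hs.2⟩

theorem countP_le_of_lt {p b : Fin n} (h : p ≤ b) {l : List (Pos n)} (hl : l.Nodup)
    (hlp : ∀ s ∈ l, s.1.2 = b → s.1.1 < p) :
    (l.countP fun s => s.1.2 = b) ≤ p := by
  have := (filter_subperm_colList h hl hlp).length_le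
  rwa [← List.countP_eq_length_filter, length_colList] at this

theorem lt_of_ne_neighbours {r s : Pos n} (hr : (r.1.2 : ℕ) = r.1.1 + 1) (hs : s ≠ r)
    (h : s.1.2 = r.1.2) : s.1.1 < r.1.1 := by
  have h1 := s.2
  have h2 : (s.1.1 : ℕ) ≠ r.1.1 := fun h' => hs (Subtype.ext (Prod.ext (Fin.ext h') h))
  rw [Fin.lt_def] at h1 ⊢
  rw [h] at h1
  omega

/-- A nonzero wedge has distinct factors. Without `e r`, column q holds at most p = q - 1 of them,
and column p at most p, which bounds the modified weights below by 2 and 1. -/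
theorem freeSub_eq_zero {r : Pos n} (hr : (r.1.2 : ℕ) = r.1.1 + 1) {w : Fin n → ℤ} {k : ℤ}
    (hw : w r.1.2 < 2 ∨ w r.1.1 < 1) {u : ExteriorAlgebra ℤ (nil n)} (hu : u ∈ freeSub r w k) :
    u = 0 := by
  rw [← Submodule.mem_bot ℤ]
  refine map_freeSub_mem LinearMap.id _ ?_ hu
  rintro l - rfl hl
  rw [Submodule.mem_bot, LinearMap.id_apply]
  refine wedge_eq_zero_of_not_nodup fun hn => ?_
  have h1 := countP_le_of_lt r.2.le hn fun s hs h =>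
    lt_of_ne_neighbours hr (fun h' => hl (h' ▸ hs)) h
  have h2 := countP_le_of_lt (le_refl r.1.1) hn fun s _ h => h ▸ s.2
  simp only [modWeight, weight] at hw
  omega

theorem raise_lower {r : Pos n} (hr : (r.1.2 : ℕ) = r.1.1 + 1) {w : Fin n → ℤ} {k : ℤ}
    {u : ExteriorAlgebra ℤ (nil n)} (hu : u ∈ freeSub r w k) :
    adExt (e r) (derExt (lower r) u) = derExt (lower r) (adExt (e r) u)
      + (1 - (w r.1.2 - w r.1.1)) • u := by
  have := derExt_commutator (fun s hs => ad_lower_commutator hr hs) hu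
  rw [derExt_ad, hr] at this
  rw [this]
  congr 2
  push_cast
  ring

theorem raise_mem {r : Pos n} (hr : (r.1.2 : ℕ) = r.1.1 + 1) {w : Fin n → ℤ} {k : ℤ}
    {u : ExteriorAlgebra ℤ (nil n)} (hu : u ∈ freeSub r w k) :
    adExt (e r) u ∈ freeSub r (w - weight [r]) k := by
  rw [← derExt_ad]
  exact (shiftsUnits_ad hr r).derExt_mem hu

theorem lower_mem {r : Pos n} {w : Fin n → ℤ} {k : ℤ}
    {u : ExteriorAlgebra ℤ (nil n)} (hu : u ∈ freeSub r w k) :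
    derExt (lower r) u ∈ freeSub r (w + weight [r]) k := by
  rw [← sub_neg_eq_add]
  exact (shiftsUnits_lower r).derExt_mem hu

theorem raise_raise {r : Pos n} {w : Fin n → ℤ} {k : ℤ}
    {u : ExteriorAlgebra ℤ (nil n)} (hu : u ∈ freeSub r w k) :
    adExt (e r) (adExt (e r) u) = (2 : ℤ) • divExt (LieAlgebra.ad ℤ (nil n) (e r)) u := by
  rw [← derExt_ad]
  exact derExt_derExt_eq (fun s _ => ad_ad_e r s) hu

theorem divExt_raise_mem {r : Pos n} (hr : (r.1.2 : ℕ) = r.1.1 + 1) {w : Fin n → ℤ} {k : ℤ}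
    {u : ExteriorAlgebra ℤ (nil n)} (hu : u ∈ freeSub r (w + weight [r]) k) :
    divExt (LieAlgebra.ad ℤ (nil n) (e r)) u ∈ freeSub r (w - weight [r]) k := by
  have := (shiftsUnits_ad hr r).divExt_mem hu
  rwa [add_sub_cancel_right] at this

/-- Twice the divided square is the square of an operator commuting with ∂, and 2 can be cancelled.
-/
theorem boundary_divExt_raise {r : Pos n} (hr : (r.1.2 : ℕ) = r.1.1 + 1) {w : Fin n → ℤ} {k : ℤ}
    {u : ExteriorAlgebra ℤ (nil n)} (hu : u ∈ freeSub r w k) :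
    boundary ℤ (nil n) (divExt (LieAlgebra.ad ℤ (nil n) (e r)) u)
      = divExt (LieAlgebra.ad ℤ (nil n) (e r)) (boundary ℤ (nil n) u) := by
  apply two_smul_cancel
  rw [← map_smul, ← raise_raise hu, ← raise_raise (boundary_mem_freeSub hr hu), boundary_adExt,
    boundary_adExt]

variable {r : Pos n} {w : Fin n → ℤ}

theorem weight_self_left (r : Pos n) : weight [r] r.1.1 = -1 := by
  simp [weight_singleton, r.2.ne']

theorem weight_self_right (r : Pos n) : weight [r] r.1.2 = 1 := by
  simp [weight_singleton, r.2.ne]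

/-- The sl₂ weight is -1, so a vector killed by E must be zero: EFu = -u, and F²u lies in a zero
space. -/
theorem raise_injective (hr : (r.1.2 : ℕ) = r.1.1 + 1) (hp : w r.1.1 = 3) (hq : w r.1.2 = 3)
    {k : ℤ} {u : ExteriorAlgebra ℤ (nil n)} (hu : u ∈ freeSub r (w + weight [r]) k)
    (h : adExt (e r) u = 0) : u = 0 := by
  have hF := lower_mem hu
  have hFF : derExt (lower r) (derExt (lower r) u) = 0 := by
    refine freeSub_eq_zero hr (Or.inr ?_) (lower_mem hF)
    simp only [Pi.add_apply, hp, weight_self_left]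
    norm_num
  have h1 := raise_lower hr hu
  have h2 := raise_lower hr hF
  simp only [Pi.add_apply, hp, hq, weight_self_left, weight_self_right, h, map_zero] at h1 h2
  rw [hFF, map_zero, h1, zero_add, map_smul, ← add_smul] at h2
  -- Here 0 = EFFu = F(EFu) - 3Fu = -4Fu.
  have h3 : derExt (lower r) u = 0 :=
    (smul_eq_zero.1 h2.symm).resolve_left (by norm_num)
  rw [h3, map_zero, zero_add] at h1
  exact (smul_eq_zero.1 h1.symm).resolve_left (by norm_num)

theorem raise_eq_zero (hr : (r.1.2 : ℕ) = r.1.1 + 1) (hq : w r.1.2 = 3) {k : ℤ}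
    {z : ExteriorAlgebra ℤ (nil n)} (hz : z ∈ freeSub r (w - weight [r]) k) :
    adExt (e r) z = 0 := by
  refine freeSub_eq_zero hr (Or.inl ?_) (raise_mem hr hz)
  simp only [Pi.sub_apply, hq, weight_self_right]
  norm_num

theorem raise_lower_top (hr : (r.1.2 : ℕ) = r.1.1 + 1) (hp : w r.1.1 = 3) (hq : w r.1.2 = 3)
    {k : ℤ} {z : ExteriorAlgebra ℤ (nil n)} (hz : z ∈ freeSub r (w - weight [r]) k) :
    adExt (e r) (derExt (lower r) z) = (3 : ℤ) • z := by
  have h := raise_lower hr hz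
  simp only [Pi.sub_apply, hp, hq, weight_self_left, weight_self_right, raise_eq_zero hr hq hz,
    map_zero, zero_add] at h
  rw [h]
  norm_num

theorem lower_top_mem {k : ℤ} {z : ExteriorAlgebra ℤ (nil n)}
    (hz : z ∈ freeSub r (w - weight [r]) k) : derExt (lower r) z ∈ freeSub r w k := by
  have := lower_mem hz
  rwa [sub_add_cancel] at this

/-- The key integrality statement: divisibility of Ev by 2 is the only obstruction to v being in the
image of E. -/
theorem exists_raise_eq (hr : (r.1.2 : ℕ) = r.1.1 + 1) (hp : w r.1.1 = 3) (hq : w r.1.2 = 3)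
    {k : ℤ} {v z : ExteriorAlgebra ℤ (nil n)} (hv : v ∈ freeSub r w k)
    (hz : z ∈ freeSub r (w - weight [r]) k) (h : adExt (e r) v = (2 : ℤ) • z) :
    ∃ u ∈ freeSub r (w + weight [r]) k, adExt (e r) u = v := by
  have hF := lower_top_mem hz
  have hdiv : divExt (lower r) z ∈ freeSub r (w + weight [r]) k := by
    have := (shiftsUnits_lower r).divExt_mem hz
    rwa [sub_neg_eq_add, sub_neg_eq_add, sub_add_cancel] at this
  -- The witness is Fv - F⁽²⁾z: EFv = FEv + v = 2Fz + v, and E F⁽²⁾z = 2Fz removes the excess.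
  refine ⟨derExt (lower r) v - divExt (lower r) z, sub_mem (lower_mem hv) hdiv, ?_⟩
  have h1 := raise_lower hr hv
  have h2 := raise_lower hr hF
  -- After doubling: EFFz = F(EFz) + Fz = 3Fz + Fz = 4Fz.
  have h3 : adExt (e r) (divExt (lower r) z) = (2 : ℤ) • derExt (lower r) z := by
    apply two_smul_cancel
    rw [← map_smul, ← derExt_derExt_eq (fun s _ => lower_lower_e r s) hz, h2,
      raise_lower_top hr hp hq hz, map_smul, hp, hq, smul_smul, ← add_smul]
    norm_num
  rw [map_sub, h1, h3, h, map_smul, hp, hq, sub_self, sub_zero, one_smul, add_sub_cancel_left]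

end Raising

/-! ### Embedding the exterior algebra of a smaller `nil m` and multiplying by a fixed wedge -/

section Embedding

attribute [local instance 100] LieRing.ofAssociativeRing

variable {n m : ℕ}

/-- Contraction from the right. -/
def contractR (d : Module.Dual ℤ (nil n)) :
    ExteriorAlgebra ℤ (nil n) →ₗ[ℤ] ExteriorAlgebra ℤ (nil n) :=
  (CliffordAlgebra.contractRight (Q := 0)).flip d

theorem contractR_mul_ι (d : Module.Dual ℤ (nil n)) (x : nil n) (u : ExteriorAlgebra ℤ (nil n)) :
    contractR d (u * ExteriorAlgebra.ι ℤ x) = d x • u - contractR d u * ExteriorAlgebra.ι ℤ x :=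
  CliffordAlgebra.contractRight_mul_ι (Q := 0) d x u

theorem wedge_concat (l : List (Pos n)) (s : Pos n) :
    wedge (l ++ [s]) = wedge l * ExteriorAlgebra.ι ℤ (e s) := by
  rw [wedge_append, wedge_cons, wedge_nil, mul_one]

theorem contractR_wedge {s : Pos n} {l : List (Pos n)} (h : s ∉ l) :
    contractR (entry s) (wedge l) = 0 := by
  induction l using List.reverseRecOn with
  | nil => exact CliffordAlgebra.contractRight_one (Q := 0) _
  | append_singleton l t ih =>
    simp only [List.mem_append, List.mem_singleton, not_or] at h
    rw [wedge_concat, contractR_mul_ι, ih h.1, entry_e, if_neg h.2]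
    simp

theorem contractR_wedge_concat {s : Pos n} {l : List (Pos n)} (h : s ∉ l) :
    contractR (entry s) (wedge (l ++ [s])) = wedge l := by
  rw [wedge_concat, contractR_mul_ι, contractR_wedge h, entry_e, if_pos rfl]
  simp

/-- If all brackets of `e s` with the factors of a wedge are other factors of the wedge, then `e s`
kills the wedge. -/
theorem adExt_wedge_eq_zero {s : Pos n} {l : List (Pos n)}
    (h : ∀ t ∈ l, ⁅e s, e t⁆ = 0 ∨ ∃ t' ∈ l, t' ≠ t ∧ ⁅e s, e t⁆ = e t') :
    adExt (e s) (wedge l) = 0 := by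
  rw [wedge, adExt_wedgeList]
  refine Finset.sum_eq_zero fun j _ => ?_
  have hj : (j : ℕ) < l.length := by simpa using j.2
  have hget : (l.map e).get j = e l[(j : ℕ)] := by simp
  rw [hget]
  rcases h _ (List.getElem_mem hj) with h | ⟨t', ht', hne, h⟩
  · rw [h, wedgeList_cons, map_zero, zero_mul, smul_zero]
  · have hw : wedgeList ℤ (e t' :: (l.map e).eraseIdx j) = wedge (t' :: l.eraseIdx j) := by
      simp [wedge, List.eraseIdx_map]
    rw [h, hw, wedge_eq_zero_of_not_nodup, smul_zero]
    intro hn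
    refine (List.nodup_cons.1 hn).1 ?_
    obtain ⟨i, hi, rfl⟩ := List.getElem_of_mem ht'
    refine List.mem_eraseIdx_iff_getElem.2 ⟨i, hi, ?_, rfl⟩
    rintro rfl
    exact hne rfl

theorem boundary_wedge_eq_zero {l : List (Pos n)} (h : ∀ s ∈ l, ∀ t ∈ l, ⁅e s, e t⁆ = 0) :
    boundary ℤ (nil n) (wedge l) = 0 := by
  induction l with
  | nil => simp [wedge_nil]
  | cons s l ih =>
    rw [wedge_cons, boundary_ι_mul,
      ih fun s hs t ht => h s (List.mem_cons_of_mem _ hs) t (List.mem_cons_of_mem _ ht),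
      adExt_wedge_eq_zero fun t ht => Or.inl (h s List.mem_cons_self t (List.mem_cons_of_mem _ ht))]
    simp

variable {σ : Fin m → Fin n} (hσ : StrictMono σ)

/-- The map on positions induced by a strictly monotone map on indices. -/
def mapPos (hσ : StrictMono σ) (s : Pos m) : Pos n := ⟨(σ s.1.1, σ s.1.2), hσ s.2⟩

theorem mapPos_injective : Function.Injective (mapPos hσ) := by
  intro s t h
  have h1 := congrArg (fun x : Pos n => x.1.1) h
  have h2 := congrArg (fun x : Pos n => x.1.2) h
  exact Subtype.ext (Prod.ext (hσ.injective h1) (hσ.injective h2))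

/-- The linear map `nil m → nil n` induced by a strictly monotone map on indices. -/
def inclNil : nil m →ₗ[ℤ] nil n := unitsLift fun s => e (mapPos hσ s)

theorem inclNil_lie (s t : Pos m) :
    inclNil hσ ⁅e s, e t⁆ = ⁅e (mapPos hσ s), e (mapPos hσ t)⁆ := by
  by_cases h : s.1.2 = t.1.1
  · rw [lie_e_of_eq h, lie_e_of_eq (congrArg σ h), inclNil, unitsLift_e]
    rfl
  by_cases h' : s.1.1 = t.1.2
  · rw [lie_e_of_eq' h', lie_e_of_eq' (congrArg σ h'), map_neg, inclNil, unitsLift_e]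
    rfl
  rw [lie_e_of_ne h h', lie_e_of_ne (hσ.injective.ne h) (hσ.injective.ne h'), map_zero]

/-- The map on exterior algebras induced by `inclNil`, followed by right multiplication with the
wedge of `T`. -/
def inclMul (T : List (Pos n)) : ExteriorAlgebra ℤ (nil m) →ₗ[ℤ] ExteriorAlgebra ℤ (nil n) :=
  LinearMap.mulRight ℤ (wedge T) ∘ₗ (ExteriorAlgebra.map (inclNil hσ)).toLinearMap

theorem inclMul_ι_mul (T : List (Pos n)) (x : nil m) (u : ExteriorAlgebra ℤ (nil m)) :
    inclMul hσ T (ExteriorAlgebra.ι ℤ x * u)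
      = ExteriorAlgebra.ι ℤ (inclNil hσ x) * inclMul hσ T u := by
  simp [inclMul, mul_assoc]

theorem inclMul_wedge (T : List (Pos n)) (l : List (Pos m)) :
    inclMul hσ T (wedge l) = wedge (l.map (mapPos hσ) ++ T) := by
  induction l with
  | nil => simp [inclMul, wedge_nil]
  | cons s l ih =>
    rw [wedge_cons, inclMul_ι_mul, ih, List.map_cons, List.cons_append, wedge_cons, inclNil,
      unitsLift_e]

theorem adExt_inclMul {T : List (Pos n)} (s : Pos m)
    (hT : adExt (e (mapPos hσ s)) (wedge T) = 0) (l : List (Pos m)) :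
    adExt (e (mapPos hσ s)) (inclMul hσ T (wedge l)) = inclMul hσ T (adExt (e s) (wedge l)) := by
  induction l with
  | nil =>
    rw [inclMul_wedge]
    simp [hT, wedge_nil]
  | cons t l ih =>
    have ht : inclNil hσ (e t) = e (mapPos hσ t) := unitsLift_e _ t
    simp only [wedge_cons, inclMul_ι_mul, adExt_ι_mul, map_add, ih, inclNil_lie, ht]

/-- A right factor that is closed and killed by all embedded units plays the role of the unit 1, and
the recursion for ∂ is the same on both sides. -/
theorem boundary_inclMul {T : List (Pos n)}
    (hT : ∀ s, adExt (e (mapPos hσ s)) (wedge T) = 0) (hT' : boundary ℤ (nil n) (wedge T) = 0)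
    {w : Fin m → ℤ} {k : ℤ} {u : ExteriorAlgebra ℤ (nil m)} (hu : u ∈ bracketSub w k) :
    boundary ℤ (nil n) (inclMul hσ T u) = inclMul hσ T (boundary ℤ (nil m) u) := by
  rw [← sub_eq_zero, ← Submodule.mem_bot ℤ]
  refine map_bracketSub_mem (boundary ℤ (nil n) ∘ₗ inclMul hσ T -
    inclMul hσ T ∘ₗ boundary ℤ (nil m)) _ ?_ hu
  rintro l - -
  simp only [LinearMap.sub_apply, LinearMap.comp_apply, Submodule.mem_bot, sub_eq_zero]
  induction l with
  | nil =>
    rw [inclMul_wedge]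
    simp [hT', wedge_nil]
  | cons t l ih =>
    have ht : inclNil hσ (e t) = e (mapPos hσ t) := unitsLift_e _ t
    simp only [wedge_cons, inclMul_ι_mul, boundary_ι_mul, map_add, map_neg, ih, ht,
      adExt_inclMul hσ t (hT t)]

/-- The factors of `T` are contracted away one by one from the right, where they stand, so that no
signs arise; then the units outside the image of `mapPos` are sent to 0. -/
theorem exists_retraction_inclMul {T : List (Pos n)} (hT : T.Nodup)
    (hT' : ∀ s, mapPos hσ s ∉ T) :
    ∃ ρ : ExteriorAlgebra ℤ (nil n) →ₗ[ℤ] ExteriorAlgebra ℤ (nil m),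
      ∀ l, ρ (wedge (l.map (mapPos hσ) ++ T)) = wedge l := by
  induction T using List.reverseRecOn with
  | nil =>
    classical
    let f : Pos n → nil m := fun s => if h : ∃ t, mapPos hσ t = s then e h.choose else 0
    have hf : ∀ t, f (mapPos hσ t) = e t := fun t => by
      have h : ∃ t', mapPos hσ t' = mapPos hσ t := ⟨t, rfl⟩
      simp only [f, dif_pos h]
      exact congrArg e (mapPos_injective hσ h.choose_spec)
    refine ⟨(ExteriorAlgebra.map (unitsLift f)).toLinearMap, fun l => ?_⟩
    rw [List.append_nil, AlgHom.toLinearMap_apply]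
    induction l with
    | nil => simp [wedge_nil]
    | cons s l ih => simp [wedge_cons, ih, hf]
  | append_singleton T s ih =>
    simp only [List.mem_append, List.mem_singleton, not_or] at hT'
    rw [List.nodup_append] at hT
    obtain ⟨ρ, hρ⟩ := ih hT.1 fun s => (hT' s).1
    refine ⟨ρ ∘ₗ contractR (entry s), fun l => ?_⟩
    rw [← List.append_assoc, LinearMap.comp_apply, contractR_wedge_concat, hρ]
    simp only [List.mem_append, List.mem_map, not_or, not_exists, not_and]
    exact ⟨fun t _ => (hT' t).2, fun h => hT.2.2 s h s (List.mem_singleton.2 rfl) rfl⟩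

theorem inclMul_injective {T : List (Pos n)} (hT : T.Nodup) (hT' : ∀ s, mapPos hσ s ∉ T)
    {w : Fin m → ℤ} {k : ℤ} {u : ExteriorAlgebra ℤ (nil m)} (hu : u ∈ bracketSub w k)
    (h : inclMul hσ T u = 0) : u = 0 := by
  obtain ⟨ρ, hρ⟩ := exists_retraction_inclMul hσ hT hT'
  have : ρ (inclMul hσ T u) - u = 0 := by
    rw [← Submodule.mem_bot ℤ]
    refine map_bracketSub_mem (ρ ∘ₗ inclMul hσ T - LinearMap.id) _ ?_ hu
    rintro l - -
    simp [inclMul_wedge, hρ]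
  rwa [h, map_zero, zero_sub, neg_eq_zero] at this

/-! ### The top weight space -/

theorem weight_append (l l' : List (Pos n)) (i : Fin n) :
    weight (l ++ l') i = weight l i + weight l' i := by
  simp only [weight, List.countP_append]
  push_cast
  ring

theorem weight_map_mapPos (l : List (Pos m)) (a : Fin m) :
    weight (l.map (mapPos hσ)) (σ a) = weight l a := by
  simp only [weight, List.countP_map, Function.comp_def, mapPos, hσ.injective.eq_iff]

theorem weight_map_mapPos_of_notMem (l : List (Pos m)) {i : Fin n} (hi : ∀ a, σ a ≠ i) :
    weight (l.map (mapPos hσ)) i = 0 := by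
  simp [weight, List.countP_map, Function.comp_def, mapPos, hi]

theorem weight_colList {p b : Fin n} (h : p ≤ b) (i : Fin n) :
    weight (colList p b h) i = (if i = b then (p : ℤ) else 0) - (if i < p then 1 else 0) := by
  have h1 : (colList p b h).countP (fun s => s.1.2 = i) = if i = b then (p : ℕ) else 0 := by
    split_ifs with hi
    · subst hi
      rw [List.countP_eq_length.2, length_colList]
      intro s hs
      exact decide_eq_true (mem_colList.1 hs).1
    · rw [List.countP_eq_zero]
      intro s hs hsi
      exact hi ((of_decide_eq_true hsi).symm.trans (mem_colList.1 hs).1)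
  have h2 : (colList p b h).countP (fun s => s.1.1 = i) = if i < p then 1 else 0 := by
    split_ifs with hi
    · have hmem : (⟨(i, b), lt_of_lt_of_le hi h⟩ : Pos n) ∈ colList p b h :=
        mem_colList.2 ⟨rfl, hi⟩
      rw [List.countP_congr (q := fun s => s == ⟨(i, b), lt_of_lt_of_le hi h⟩)]
      · exact List.count_eq_one_of_mem (nodup_colList p b h) hmem
      · intro s hs
        rw [decide_eq_true_eq, beq_iff_eq]
        exact ⟨fun h' => Subtype.ext (Prod.ext h' (mem_colList.1 hs).1), fun h' => h' ▸ rfl⟩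
    · rw [List.countP_eq_zero]
      intro s hs hsi
      exact hi (of_decide_eq_true hsi ▸ (mem_colList.1 hs).2)
  rw [weight, h1, h2]
  push_cast
  rfl

end Embedding

/-! ### The top weight space as the complex of the merged weight -/

section Merge

attribute [local instance 100] LieRing.ofAssociativeRing

variable {n m : ℕ}

/-- The weight `w'` arises from `w` by deleting the first index, and merging the two neighbouring
indices of `r`; the map `σ` skips the first index and the second index of `r`. -/
structure IsMerge (r : Pos n) (w : Fin n → ℤ) (σ : Fin m → Fin n) (w' : Fin m → ℤ) : Prop where
  adj : (r.1.2 : ℕ) = r.1.1 + 1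
  pos : 0 < (r.1.1 : ℕ)
  left : w r.1.1 = 3
  right : w r.1.2 = 3
  zero : ∀ i : Fin n, (i : ℕ) = 0 → w i = 2
  mono : StrictMono σ
  range : ∀ i : Fin n, (∃ a, σ a = i) ↔ (i : ℕ) ≠ 0 ∧ i ≠ r.1.2
  -- The difference a - σ(a) renumbers the indices; the last term accounts for the factor (σ(a), q)
  -- of the column wedge.
  weight_eq : ∀ a, w' a = w (σ a) - weight [r] (σ a) + (a : ℕ) - (σ a : ℕ)
    - if σ a < r.1.1 then 1 else 0

/-- The positions `(t, q)` with `t < p`, where `r = (p, q)`. -/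
abbrev col (r : Pos n) : List (Pos n) := colList r.1.1 r.1.2 r.2.le

namespace IsMerge

variable {r : Pos n} {w : Fin n → ℤ} {σ : Fin m → Fin n} {w' : Fin m → ℤ}
  (h : IsMerge r w σ w')

include h

theorem σ_ne_right (a : Fin m) : σ a ≠ r.1.2 := ((h.range _).1 ⟨a, rfl⟩).2

theorem mapPos_notMem_col (s : Pos m) : mapPos h.mono s ∉ col r := fun hs =>
  h.σ_ne_right _ (mem_colList.1 hs).1

/-- At an index in the image of σ the two conditions differ by the constants of `weight_eq`. At 0
and q, which the remaining wedge does not meet, the column alone has the required weight. -/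
theorem modWeight_iff (l : List (Pos m)) :
    modWeight (l.map (mapPos h.mono) ++ col r) = w - weight [r] ↔ modWeight l = w' := by
  have hadj := h.adj
  have hpos := h.pos
  have key : ∀ a, modWeight (l.map (mapPos h.mono) ++ col r) (σ a) = (w - weight [r]) (σ a) ↔
      modWeight l a = w' a := fun a => by
    have h1 := h.weight_eq a
    simp only [modWeight, weight_append, weight_map_mapPos, weight_colList,
      if_neg (h.σ_ne_right a), Pi.sub_apply]
    constructor <;> intro h2 <;> linarith
  constructor
  · intro hl
    funext a
    exact (key a).1 (congrFun hl _)
  · intro hl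
    funext i
    by_cases hi : ∃ a, σ a = i
    · obtain ⟨a, rfl⟩ := hi
      exact (key a).2 (congrFun hl a)
    · have hi' := hi
      rw [h.range, not_and_or, not_not, not_not] at hi'
      simp only [modWeight, weight_append, weight_colList, Pi.sub_apply, weight_singleton,
        weight_map_mapPos_of_notMem h.mono l (not_exists.1 hi)]
      rcases hi' with hi' | rfl
      · have hw := h.zero i hi'
        have h1 : i ≠ r.1.2 := fun h' => by rw [h'] at hi'; omega
        have h2 : i ≠ r.1.1 := fun h' => by rw [h'] at hi'; omega
        have h3 : i < r.1.1 := Fin.lt_def.2 (by omega)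
        rw [if_neg h1, if_neg h1.symm, if_neg h2.symm, if_pos h3, hi', hw]
        norm_num
      · have h1 := r.2
        rw [if_pos rfl, if_pos rfl, if_neg h1.ne, if_neg h1.not_gt, h.right, hadj]
        push_cast
        ring

theorem notMem_map_append_col (l : List (Pos m)) : r ∉ l.map (mapPos h.mono) ++ col r := by
  rw [List.mem_append, not_or]
  constructor
  · intro hr
    obtain ⟨s, -, hs⟩ := List.mem_map.1 hr
    exact h.σ_ne_right _ (congrArg (fun x : Pos n => x.1.2) hs)
  · exact fun hr => (mem_colList.1 hr).2.ne rfl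

theorem inclMul_mem {k : ℤ} {u : ExteriorAlgebra ℤ (nil m)}
    (hu : u ∈ bracketSub w' (k - (r.1.1 : ℕ))) :
    inclMul h.mono (col r) u ∈ freeSub r (w - weight [r]) k := by
  refine map_bracketSub_mem _ _ ?_ hu
  intro l hl hlw
  rw [inclMul_wedge]
  refine Submodule.subset_span ⟨_, ?_, (h.modWeight_iff l).2 hlw, h.notMem_map_append_col l, rfl⟩
  rw [List.length_append, List.length_map, length_colList]
  push_cast
  omega

/-- Extremality at q fills the column and empties row q; the entry 2 at index 0 then excludes index
0 from all remaining factors. -/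
theorem exists_perm {l : List (Pos n)} (hl : l.Nodup) (hr : r ∉ l)
    (hlw : modWeight l = w - weight [r]) :
    ∃ l' : List (Pos m), (l'.map (mapPos h.mono) ++ col r).Perm l := by
  have hadj := h.adj
  have hpos := h.pos
  have hlt : ∀ s ∈ l, s.1.2 = r.1.2 → s.1.1 < r.1.1 := fun s hs h' =>
    lt_of_ne_neighbours hadj (fun h'' => hr (h'' ▸ hs)) h'
  have hsub := filter_subperm_colList r.2.le hl hlt
  have hle := countP_le_of_lt r.2.le hl hlt
  have hright := congrFun hlw r.1.2
  rw [Pi.sub_apply, h.right, weight_self_right] at hright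
  simp only [modWeight, weight] at hright
  -- The modified weight 2 at q says that column q has p more factors than row q, and it has at most
  -- p.
  have hcol : (l.filter fun s => s.1.2 = r.1.2).Perm (col r) := by
    refine hsub.perm_of_length_le ?_
    rw [length_colList, ← List.countP_eq_length_filter]
    omega
  have hrow : l.countP (fun s => s.1.1 = r.1.2) = 0 := by omega
  obtain ⟨z, hz0⟩ : ∃ z : Fin n, (z : ℕ) = 0 := ⟨⟨0, by omega⟩, rfl⟩
  have hz : z < r.1.1 := Fin.lt_def.2 (by omega)
  have hzr : (⟨(z, r.1.2), hz.trans r.2⟩ : Pos n) ∈ l :=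
    (List.mem_filter.1 (hcol.mem_iff.2
      (mem_colList (s := ⟨(z, r.1.2), hz.trans r.2⟩).2 ⟨rfl, hz⟩))).1
  have hzero := congrFun hlw z
  have hcz : l.countP (fun s => s.1.2 = z) = 0 := by
    rw [List.countP_eq_zero]
    intro s _ hs
    have := s.2
    rw [of_decide_eq_true hs, Fin.lt_def] at this
    omega
  rw [Pi.sub_apply, h.zero z hz0, weight_singleton, if_neg (hz.trans r.2).ne',
    if_neg hz.ne'] at hzero
  simp only [modWeight, weight, hcz, hz0] at hzero
  -- Column 0 is empty, so the modified weight 2 = 1 + 1 means exactly one factor in row 0; it must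
  -- be (0, q).
  have hone : l.countP (fun s => s.1.1 = z) = 1 := by
    push_cast at hzero
    omega
  rw [List.countP_eq_length_filter, List.length_eq_one_iff] at hone
  obtain ⟨s0, hs0⟩ := hone
  have hfirst : ∀ s ∈ l, s.1.1 = z → s = s0 := fun s hs h' => by
    have : s ∈ l.filter fun s => s.1.1 = z := List.mem_filter.2 ⟨hs, decide_eq_true h'⟩
    rwa [hs0, List.mem_singleton] at this
  have hmem : ∀ s ∈ l.filter (fun s => !decide (s.1.2 = r.1.2)),
      ∃ t, mapPos h.mono t = s := by
    intro s hs
    rw [List.mem_filter, Bool.not_eq_true', decide_eq_false_iff_not] at hs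
    have h1 : (s.1.1 : ℕ) ≠ 0 := fun h' => by
      have h'' : s.1.1 = z := Fin.ext (h'.trans hz0.symm)
      rw [hfirst s hs.1 h'', ← hfirst _ hzr rfl] at hs
      exact hs.2 rfl
    have h2 : s.1.1 ≠ r.1.2 := fun h' => by
      rw [List.countP_eq_zero] at hrow
      exact hrow s hs.1 (decide_eq_true h')
    have hs' := s.2
    obtain ⟨a, ha⟩ := (h.range s.1.1).2 ⟨h1, h2⟩
    obtain ⟨b, hb⟩ := (h.range s.1.2).2 ⟨by rw [Fin.lt_def] at hs'; omega, hs.2⟩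
    refine ⟨⟨(a, b), h.mono.lt_iff_lt.1 (by rw [ha, hb]; exact hs')⟩, ?_⟩
    exact Subtype.ext (Prod.ext ha hb)
  obtain ⟨l', hl'⟩ : ∃ l', List.map (mapPos h.mono) l'
      = l.filter (fun s => !decide (s.1.2 = r.1.2)) := by
    rw [← Set.mem_range, Set.range_list_map]
    exact hmem
  refine ⟨l', ?_⟩
  rw [hl']
  exact (List.perm_append_comm.trans (hcol.symm.append_right _)).trans
    (List.filter_append_perm _ l)

theorem exists_inclMul {k : ℤ} {z : ExteriorAlgebra ℤ (nil n)}
    (hz : z ∈ freeSub r (w - weight [r]) k) :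
    ∃ u ∈ bracketSub w' (k - (r.1.1 : ℕ)), inclMul h.mono (col r) u = z := by
  rw [← Submodule.mem_map]
  refine map_freeSub_mem LinearMap.id _ ?_ hz
  intro l hlk hlw hr
  rw [LinearMap.id_apply]
  by_cases hl : l.Nodup
  · obtain ⟨l', hl'⟩ := h.exists_perm hl hr hlw
    have hmem : wedge l' ∈ bracketSub w' (k - (r.1.1 : ℕ)) := by
      refine Submodule.subset_span ⟨l', ?_, ?_, rfl⟩
      · have := hl'.length_eq
        rw [List.length_append, List.length_map, length_colList] at this
        omega
      · rw [← h.modWeight_iff, modWeight_perm hl', hlw]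
    rcases wedge_perm hl' with hw | hw
    · exact ⟨wedge l', hmem, by rw [inclMul_wedge, hw]⟩
    · exact ⟨-wedge l', neg_mem hmem, by rw [map_neg, inclMul_wedge, hw, neg_neg]⟩
  · rw [wedge_eq_zero_of_not_nodup hl]
    exact zero_mem _

/-- The identification of the top weight space with the complex of the merged weight. -/
def topEquiv (k : ℤ) :
    bracketSub w' (k - (r.1.1 : ℕ)) ≃ₗ[ℤ] freeSub r (w - weight [r]) k :=
  LinearEquiv.ofBijective ((inclMul h.mono (col r)).restrict fun _ hu => h.inclMul_mem hu) <| by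
    constructor
    · rw [← LinearMap.ker_eq_bot, LinearMap.ker_eq_bot']
      intro u hu
      exact Subtype.ext (inclMul_injective h.mono (nodup_colList _ _ _) h.mapPos_notMem_col u.2
        (congrArg Subtype.val hu))
    · intro z
      obtain ⟨u, hu, huz⟩ := h.exists_inclMul z.2
      exact ⟨⟨u, hu⟩, Subtype.ext huz⟩

theorem coe_topEquiv {k : ℤ} (u : bracketSub w' (k - (r.1.1 : ℕ))) :
    (h.topEquiv k u : ExteriorAlgebra ℤ (nil n)) = inclMul h.mono (col r) u := rfl

/-- An embedded unit (a, t) moves (t, q) to (a, q) with a < t, another factor of the column, so it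
kills the column wedge. The units of the column commute, so that wedge is closed. -/
theorem boundary_inclMul_col {k : ℤ} {u : ExteriorAlgebra ℤ (nil m)} (hu : u ∈ bracketSub w' k) :
    boundary ℤ (nil n) (inclMul h.mono (col r) u)
      = inclMul h.mono (col r) (boundary ℤ (nil m) u) := by
  refine boundary_inclMul h.mono (fun s => adExt_wedge_eq_zero fun t ht => ?_) ?_ hu
  · rw [mem_colList] at ht
    by_cases h1 : (mapPos h.mono s).1.2 = t.1.1
    · refine Or.inr ⟨⟨((mapPos h.mono s).1.1, t.1.2),
        (mapPos h.mono s).2.trans (h1.trans_lt t.2)⟩, mem_colList.2 ⟨ht.1, ?_⟩, ?_, lie_e_of_eq h1⟩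
      · exact ((mapPos h.mono s).2.trans_eq h1).trans ht.2
      · intro h2
        have h3 := congrArg (fun x : Pos n => x.1.1) h2
        exact ((mapPos h.mono s).2.trans_eq h1).ne h3
    · exact Or.inl (lie_e_of_ne h1 (ht.1 ▸ h.σ_ne_right _))
  · refine boundary_wedge_eq_zero fun s hs t ht => ?_
    rw [mem_colList] at hs ht
    refine lie_e_of_ne ?_ ?_
    · rw [hs.1]
      exact (ht.2.trans r.2).ne'
    · rw [ht.1]
      exact (hs.2.trans r.2).ne

end IsMerge

end Merge

/-! ### The comparison map to the cone and its effect on homology -/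

section Comparison

attribute [local instance 100] LieRing.ofAssociativeRing

variable {n m : ℕ}

/-- The differential of `⟦w⟧` as a linear map. -/
def bracketD (w : Fin n → ℤ) {i j : ℤ} (hij : j + 1 = i) : bracketSub w i →ₗ[ℤ] bracketSub w j :=
  (boundary ℤ (nil n)).restrict fun _ hu => boundary_mem hij hu

theorem bracketComplex_d (w : Fin n → ℤ) {i j : ℤ} (hij : j + 1 = i) :
    (bracketComplex w).d i j = ModuleCat.ofHom (bracketD w hij) := dif_pos hij

theorem ι_mul_mem_bracketSub {r : Pos n} {w : Fin n → ℤ} {k : ℤ}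
    {u : ExteriorAlgebra ℤ (nil n)} (hu : u ∈ freeSub r (w + weight [r]) k) :
    ExteriorAlgebra.ι ℤ (e r) * u ∈ bracketSub w (k + 1) := by
  have := ι_mul_mem (freeSub_le _ _ _ hu) r
  simpa using this

theorem contract_ι_mul_add {r : Pos n} {w w' : Fin n → ℤ} {k k' : ℤ}
    {u v : ExteriorAlgebra ℤ (nil n)} (hu : u ∈ freeSub r w k) (hv : v ∈ freeSub r w' k') :
    contract (entry r) (ExteriorAlgebra.ι ℤ (e r) * u + v) = u := by
  rw [map_add, contract_ι_mul_freeSub hu, contract_freeSub hv, add_zero]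

theorem boundary_decomp {r : Pos n} (u v : ExteriorAlgebra ℤ (nil n)) :
    boundary ℤ (nil n) (ExteriorAlgebra.ι ℤ (e r) * u + v)
      = ExteriorAlgebra.ι ℤ (e r) * (-boundary ℤ (nil n) u)
        + (boundary ℤ (nil n) v - adExt (e r) u) := by
  rw [map_add, boundary_ι_mul, mul_neg]
  abel

/-- Every element of `⟦w⟧` is a unique sum of a multiple of `e r` and of an element that avoids
`e r`. -/
theorem exists_decomp (r : Pos n) {w : Fin n → ℤ} {k : ℤ} {z : ExteriorAlgebra ℤ (nil n)}
    (hz : z ∈ bracketSub w k) :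
    ∃ u ∈ freeSub r (w + weight [r]) (k - 1), ∃ v ∈ freeSub r w k,
      z = ExteriorAlgebra.ι ℤ (e r) * u + v :=
  ⟨_, contract_mem hz, _, sub_contract_mem hz, by abel⟩

/-- The differential of the shift of `⟦w'⟧` as a linear map. -/
abbrev mergedD (r : Pos n) (w' : Fin m → ℤ) {i j : ℤ} (hij : j + 1 = i) :
    bracketSub w' (i - (r.1.1 : ℕ)) →ₗ[ℤ] bracketSub w' (j - (r.1.1 : ℕ)) :=
  bracketD w' (by rw [← hij]; ring)

namespace IsMerge

variable {r : Pos n} {w : Fin n → ℤ} {σ : Fin m → Fin n} {w' : Fin m → ℤ}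
  (h : IsMerge r w σ w')

/-- The component `e r ∧ u + v ↦ -(E ^ 2 / 2) u` of the comparison map, where `E` is the action of
`e r`. -/
def compFst {i j : ℤ} (hij : j + 1 = i) :
    bracketSub w i →ₗ[ℤ] bracketSub w' (j - (r.1.1 : ℕ)) :=
  (h.topEquiv j).symm.toLinearMap ∘ₗ
    (-(divExt (LieAlgebra.ad ℤ (nil n) (e r)) ∘ₗ contract (entry r))).restrict fun u hu => by
      obtain rfl : j = i - 1 := by omega
      exact neg_mem (divExt_raise_mem h.adj (contract_mem hu))

/-- The component `e r ∧ u + v ↦ E v` of the comparison map, where `E` is the action of `e r`. -/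
def compSnd (i : ℤ) : bracketSub w i →ₗ[ℤ] bracketSub w' (i - (r.1.1 : ℕ)) :=
  (h.topEquiv i).symm.toLinearMap ∘ₗ
    (adExt (e r) ∘ₗ (LinearMap.id - LinearMap.mulLeft ℤ (ExteriorAlgebra.ι ℤ (e r)) ∘ₗ
      contract (entry r))).restrict fun _ hu => raise_mem h.adj (sub_contract_mem hu)

/-- The embedding of the complex of the merged weight. -/
abbrev emb (h : IsMerge r w σ w') :
    ExteriorAlgebra ℤ (nil m) →ₗ[ℤ] ExteriorAlgebra ℤ (nil n) := inclMul h.mono (col r)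

theorem emb_injective {k : ℤ} {u v : bracketSub w' (k - (r.1.1 : ℕ))} (huv : h.emb u = h.emb v) :
    u = v :=
  (h.topEquiv k).injective (Subtype.ext huv)

theorem emb_symm {k : ℤ} (z : freeSub r (w - weight [r]) k) :
    h.emb ((h.topEquiv k).symm z) = z := by
  rw [← h.coe_topEquiv, LinearEquiv.apply_symm_apply]

theorem emb_mem {k : ℤ} (u : bracketSub w' (k - (r.1.1 : ℕ))) :
    h.emb u ∈ freeSub r (w - weight [r]) k := h.inclMul_mem u.2

theorem emb_d {i j : ℤ} (hij : j + 1 = i) (u : bracketSub w' (i - (r.1.1 : ℕ))) :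
    h.emb (mergedD r w' hij u) = boundary ℤ (nil n) (h.emb u) := by
  rw [emb, h.boundary_inclMul_col u.2]
  rfl

theorem emb_compFst {i j : ℤ} (hij : j + 1 = i) {z : bracketSub w i} {u v}
    (hu : u ∈ freeSub r (w + weight [r]) (i - 1)) (hv : v ∈ freeSub r w i)
    (hz : (z : ExteriorAlgebra ℤ (nil n)) = ExteriorAlgebra.ι ℤ (e r) * u + v) :
    h.emb (h.compFst hij z) = -divExt (LieAlgebra.ad ℤ (nil n) (e r)) u := by
  have h1 : contract (entry r) (z : ExteriorAlgebra ℤ (nil n)) = u := by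
    rw [hz, contract_ι_mul_add hu hv]
  rw [compFst, LinearMap.comp_apply, LinearEquiv.coe_coe, emb_symm, LinearMap.coe_restrict_apply]
  simp [h1]

theorem emb_compSnd {i : ℤ} {z : bracketSub w i} {u v}
    (hu : u ∈ freeSub r (w + weight [r]) (i - 1)) (hv : v ∈ freeSub r w i)
    (hz : (z : ExteriorAlgebra ℤ (nil n)) = ExteriorAlgebra.ι ℤ (e r) * u + v) :
    h.emb (h.compSnd i z) = adExt (e r) v := by
  have h1 : contract (entry r) (z : ExteriorAlgebra ℤ (nil n)) = u := by
    rw [hz, contract_ι_mul_add hu hv]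
  rw [compSnd, LinearMap.comp_apply, LinearEquiv.coe_coe, emb_symm, LinearMap.coe_restrict_apply]
  simp only [LinearMap.comp_apply, LinearMap.sub_apply, LinearMap.id_apply,
    LinearMap.mulLeft_apply, h1]
  rw [hz, add_sub_cancel_left]

theorem boundary_parts_mem (h : IsMerge r w σ w') {i j : ℤ} (hij : j + 1 = i)
    {u v : ExteriorAlgebra ℤ (nil n)}
    (hu : u ∈ freeSub r (w + weight [r]) (i - 1)) (hv : v ∈ freeSub r w i) :
    -boundary ℤ (nil n) u ∈ freeSub r (w + weight [r]) (j - 1) ∧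
      boundary ℤ (nil n) v - adExt (e r) u ∈ freeSub r w j := by
  obtain rfl : j = i - 1 := by omega
  refine ⟨neg_mem (boundary_mem_freeSub h.adj hu), sub_mem (boundary_mem_freeSub h.adj hv) ?_⟩
  have := raise_mem h.adj hu
  rwa [add_sub_cancel_right] at this

theorem compFst_d {i j k : ℤ} (hij : j + 1 = i) (hjk : k + 1 = j) (z : bracketSub w i) :
    h.compFst hjk (bracketD w hij z) = -mergedD r w' hjk (h.compFst hij z) := by
  obtain ⟨u, hu, v, hv, hz⟩ := exists_decomp r z.2
  obtain ⟨hu', hv'⟩ := h.boundary_parts_mem hij hu hv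
  apply h.emb_injective
  have h1 : (bracketD w hij z : ExteriorAlgebra ℤ (nil n)) = _ :=
    (congrArg _ hz).trans (boundary_decomp u v)
  rw [h.emb_compFst hjk hu' hv' h1, map_neg, neg_neg, ← boundary_divExt_raise h.adj hu,
    Submodule.coe_neg, map_neg, h.emb_d, h.emb_compFst hij hu hv hz, map_neg, neg_neg]

/-- The factor 2 of the cone arises from E² = 2E⁽²⁾: applying E to the part ∂v - Eu of the boundary
gives ∂Ev - 2E⁽²⁾u. -/
theorem compSnd_d {i j : ℤ} (hij : j + 1 = i) (z : bracketSub w i) :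
    h.compSnd j (bracketD w hij z)
      = (2 : ℤ) • h.compFst hij z + mergedD r w' hij (h.compSnd i z) := by
  obtain ⟨u, hu, v, hv, hz⟩ := exists_decomp r z.2
  obtain ⟨hu', hv'⟩ := h.boundary_parts_mem hij hu hv
  apply h.emb_injective
  have h1 : (bracketD w hij z : ExteriorAlgebra ℤ (nil n)) = _ :=
    (congrArg _ hz).trans (boundary_decomp u v)
  rw [h.emb_compSnd hu' hv' h1, Submodule.coe_add, Submodule.coe_smul, map_add, map_smul, h.emb_d,
    h.emb_compFst hij hu hv hz, h.emb_compSnd hu hv hz, map_sub, boundary_adExt,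
    raise_raise hu, smul_neg]
  abel

/-- Injectivity on homology. Subtracting ∂Fc from v makes its image under E divisible by 2, hence it
is Eu'; then ∂u' = u follows because E is injective. -/
theorem exists_boundary_eq (h : IsMerge r w σ w') {j : ℤ} {z : ExteriorAlgebra ℤ (nil n)}
    {u v b c : ExteriorAlgebra ℤ (nil n)}
    (hu : u ∈ freeSub r (w + weight [r]) (j - 1)) (hv : v ∈ freeSub r w j)
    (hz : z = ExteriorAlgebra.ι ℤ (e r) * u + v) (hz0 : boundary ℤ (nil n) z = 0)
    (hb : b ∈ freeSub r (w - weight [r]) j) (hc : c ∈ freeSub r (w - weight [r]) (j + 1))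
    (hy : adExt (e r) v = (2 : ℤ) • b + boundary ℤ (nil n) c) :
    ∃ z' ∈ bracketSub w (j + 1), boundary ℤ (nil n) z' = z := by
  obtain ⟨hu', hv'⟩ := h.boundary_parts_mem (sub_add_cancel j 1) hu hv
  have hdec := boundary_decomp (r := r) u v
  rw [← hz, hz0] at hdec
  have hbu : -boundary ℤ (nil n) u = 0 := by
    rw [← contract_ι_mul_add hu' hv', ← hdec, map_zero]
  have hEu : adExt (e r) u = boundary ℤ (nil n) v := by
    rw [hbu, mul_zero, zero_add] at hdec
    exact (sub_eq_zero.1 hdec.symm).symm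
  have hF := lower_top_mem hc
  have hbF := boundary_mem_freeSub h.adj hF
  have hbc := boundary_mem_freeSub h.adj hc
  rw [add_sub_cancel_right] at hbF hbc
  -- As EF = 3, E(v - ∂Fc) = 2b + ∂c - 3∂c = 2(b - ∂c).
  obtain ⟨u', hu'', hE⟩ := exists_raise_eq h.adj h.left h.right (sub_mem hv hbF)
    (sub_mem hb hbc) (by
      rw [map_sub, hy, ← boundary_adExt, raise_lower_top h.adj h.left h.right hc, map_smul,
        smul_sub]
      module)
  refine ⟨derExt (lower r) c - ExteriorAlgebra.ι ℤ (e r) * u',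
    sub_mem (freeSub_le _ _ _ hF) (ι_mul_mem_bracketSub hu''), ?_⟩
  have huu : u - boundary ℤ (nil n) u' = 0 := by
    refine raise_injective h.adj h.left h.right (sub_mem hu (boundary_mem_freeSub h.adj hu'')) ?_
    rw [map_sub, hEu, ← boundary_adExt, hE, map_sub, boundary_boundary, sub_zero, sub_self]
  rw [map_sub, boundary_ι_mul, hE, hz, ← sub_eq_zero.1 huu]
  abel

/-- Surjectivity on homology, up to the factor 3 coming from EF = 3: take v = Fc and solve Eu = ∂v,
which is possible since E∂v = 3∂c = -6b is even. -/
theorem exists_cycle_of_cone (h : IsMerge r w σ w') {j : ℤ} {b c : ExteriorAlgebra ℤ (nil n)}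
    (hb : b ∈ freeSub r (w - weight [r]) (j - 1)) (hc : c ∈ freeSub r (w - weight [r]) j)
    (hbc : (2 : ℤ) • b + boundary ℤ (nil n) c = 0) :
    ∃ u ∈ freeSub r (w + weight [r]) (j - 1), ∃ v ∈ freeSub r w j,
      boundary ℤ (nil n) (ExteriorAlgebra.ι ℤ (e r) * u + v) = 0 ∧
      -divExt (LieAlgebra.ad ℤ (nil n) (e r)) u = (3 : ℤ) • b ∧ adExt (e r) v = (3 : ℤ) • c := by
  have hF := lower_top_mem hc
  have hEF := raise_lower_top h.adj h.left h.right hc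
  have hcb : boundary ℤ (nil n) c = -((2 : ℤ) • b) := (neg_eq_of_add_eq_zero_right hbc).symm
  have hE : adExt (e r) (boundary ℤ (nil n) (derExt (lower r) c))
      = (2 : ℤ) • -((3 : ℤ) • b) := by
    rw [← boundary_adExt, hEF, map_smul, hcb]
    module
  obtain ⟨u, hu, hEu⟩ := exists_raise_eq h.adj h.left h.right (boundary_mem_freeSub h.adj hF)
    (neg_mem (Submodule.smul_mem _ 3 hb)) hE
  have hbu : boundary ℤ (nil n) u = 0 := by
    refine raise_injective h.adj h.left h.right (boundary_mem_freeSub h.adj hu) ?_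
    rw [← boundary_adExt, hEu, boundary_boundary]
  refine ⟨u, hu, _, hF, ?_, ?_, hEF⟩
  · rw [boundary_decomp, hbu, hEu, neg_zero, mul_zero, sub_self, zero_add]
  · apply two_smul_cancel
    rw [smul_neg, ← raise_raise hu, hEu, hE, smul_neg, neg_neg]

theorem exists_bracketD_eq {j k : ℤ} (hjk : k + 1 = j) (z : bracketSub w j)
    (b : bracketSub w' (j - (r.1.1 : ℕ))) (c : bracketSub w' (j + 1 - (r.1.1 : ℕ)))
    (hz : bracketD w hjk z = 0)
    (hy : h.compSnd j z = (2 : ℤ) • b + mergedD r w' rfl c) :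
    ∃ z' : bracketSub w (j + 1), bracketD w rfl z' = z := by
  obtain ⟨u, hu, v, hv, hzuv⟩ := exists_decomp r z.2
  have hE : adExt (e r) v = (2 : ℤ) • h.emb b + boundary ℤ (nil n) (h.emb c) := by
    rw [← h.emb_compSnd hu hv hzuv, hy, Submodule.coe_add, map_add, h.emb_d, Submodule.coe_smul,
      map_smul]
  obtain ⟨z', hz', hzz⟩ := h.exists_boundary_eq hu hv hzuv (congrArg Subtype.val hz)
    (h.emb_mem b) (h.emb_mem c) hE
  exact ⟨⟨z', hz'⟩, Subtype.ext hzz⟩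

/-- The triple of a cone cycle (b, c) is homologous to it: 2(b, c) = (-∂c, 2c) is the boundary of
(c, 0), because 2b = -∂c. -/
theorem exists_cycle_eq {j k : ℤ} (hjk : k + 1 = j) (b : bracketSub w' (k - (r.1.1 : ℕ)))
    (c : bracketSub w' (j - (r.1.1 : ℕ))) (hbc : (2 : ℤ) • b + mergedD r w' hjk c = 0) :
    ∃ z : bracketSub w j, bracketD w hjk z = 0 ∧ h.compFst hjk z = b - mergedD r w' hjk c ∧
      h.compSnd j z = c + (2 : ℤ) • c := by
  obtain rfl : k = j - 1 := by omega
  have hsum : (2 : ℤ) • h.emb b + boundary ℤ (nil n) (h.emb c) = 0 := by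
    rw [← h.emb_d hjk, ← map_smul, ← map_add, ← Submodule.coe_smul, ← Submodule.coe_add, hbc,
      Submodule.coe_zero, map_zero]
  obtain ⟨u, hu, v, hv, hz0, hx, hy⟩ := h.exists_cycle_of_cone (h.emb_mem b) (h.emb_mem c) hsum
  have hmem : ExteriorAlgebra.ι ℤ (e r) * u + v ∈ bracketSub w j := by
    have := ι_mul_mem_bracketSub hu
    rw [sub_add_cancel] at this
    exact add_mem this (freeSub_le _ _ _ hv)
  refine ⟨⟨_, hmem⟩, Subtype.ext hz0, ?_, ?_⟩
  · apply h.emb_injective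
    rw [h.emb_compFst hjk hu hv rfl, hx, Submodule.coe_sub, map_sub, h.emb_d,
      ← neg_eq_of_add_eq_zero_right hsum]
    module
  · apply h.emb_injective
    rw [h.emb_compSnd hu hv rfl, hy, Submodule.coe_add, Submodule.coe_smul, map_add, map_smul]
    module

/-- The homology of `⟦w⟧` is that of the cone of multiplication by `2` on the shift of the complex
of the merged weight. -/
theorem homology_iso (h : IsMerge r w σ w') (j : ℤ) :
    Nonempty ((bracketComplex w).homology j ≅
      (coneMul 2 (shift (bracketComplex w') (r.1.1 : ℕ))).homology j) := by
  have hA : ∀ i j (hij : j + 1 = i), (bracketComplex w).d i j = ModuleCat.ofHom (bracketD w hij) :=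
    fun i j hij => bracketComplex_d w hij
  have hB : ∀ i j (hij : j + 1 = i), (shift (bracketComplex w') (r.1.1 : ℕ)).d i j
      = ModuleCat.ofHom (mergedD r w' hij) := fun i j hij => bracketComplex_d w' (by rw [← hij]; ring)
  refine homology_iso_coneMul 2 (fun i j hij => ModuleCat.ofHom (h.compFst hij))
    (fun i => ModuleCat.ofHom (h.compSnd i)) ?_ ?_ (i := j + 1) (k := j - 1) rfl
    (sub_add_cancel j 1) ?_ ?_
  · intro i j k hij hjk
    rw [hA i j hij, hB j k hjk]
    exact ModuleCat.hom_ext (LinearMap.ext fun z => h.compFst_d hij hjk z)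
  · intro i j hij
    rw [hA i j hij, hB i j hij]
    exact ModuleCat.hom_ext (LinearMap.ext fun z => h.compSnd_d hij z)
  · rw [hA (j + 1) j rfl, hA j (j - 1) (sub_add_cancel j 1), hB (j + 1) j rfl]
    exact fun z b c hz hy => h.exists_bracketD_eq (sub_add_cancel j 1) z b c hz hy
  · rw [hA j (j - 1) (sub_add_cancel j 1), hB (j + 1) j rfl, hB j (j - 1) (sub_add_cancel j 1)]
    intro b c hbc
    obtain ⟨z, hz, hx, hy⟩ := h.exists_cycle_eq (sub_add_cancel j 1) b c hbc
    -- The element (c, 0) of the cone bounds the difference between 3(b, c) and (b, c).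
    refine ⟨z, c, 0, hz, hx, ?_⟩
    rw [map_zero, add_zero]
    exact hy

end IsMerge

end Comparison

end NilTorsion

end

/-! ### The weights of the statement as an instance of `IsMerge` -/

theorem lemma3p4 (k : ℕ) (a b : List ℤ) (hk : a.length + 1 = k)
    (w w' : List ℤ)
    (hw : w = 2 :: a ++ [3, 3] ++ b)
    (hw' : w' = a.map (fun x => x - 2) ++ [3] ++ b.map (fun x => x - 2)) (j : ℤ) :
    Nonempty ((NilTorsion.bracketComplex w.get).homology j ≅
      (NilTorsion.coneMul 2 (NilTorsion.shift (NilTorsion.bracketComplex w'.get) k)).homology j) := by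
  have hn : w.length = k + 2 + b.length := by simp [hw]; omega
  have hm : w'.length = k + b.length := by simp [hw']; omega
  -- Counted from 0, the two entries 3 stand at k and k + 1; σ skips 0 and k + 1.
  let r : NilTorsion.Pos w.length := ⟨(⟨k, by omega⟩, ⟨k + 1, by omega⟩), Nat.lt_succ_self k⟩
  let σ : Fin w'.length → Fin w.length := fun x =>
    ⟨if (x : ℕ) < k then x + 1 else x + 2, by have := x.2; split_ifs <;> omega⟩
  have hσ : ∀ x, (σ x : ℕ) = if (x : ℕ) < k then (x : ℕ) + 1 else x + 2 := fun _ => rfl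
  have h : NilTorsion.IsMerge r w.get σ w'.get :=
    { adj := rfl
      pos := by change 0 < k; omega
      left := by subst hw hk; simp [r]
      right := by subst hw hk; simp [r]
      zero := by
        rintro ⟨i, hi⟩ (rfl : i = 0)
        subst hw
        rfl
      mono := by
        intro x y hxy
        rw [Fin.lt_def] at hxy ⊢
        rw [hσ, hσ]
        split_ifs <;> omega
      range := by
        intro i
        have hi2 := i.2
        simp only [Fin.ext_iff, hσ, ne_eq]
        constructor
        · rintro ⟨x, hx⟩
          change (i : ℕ) ≠ 0 ∧ (i : ℕ) ≠ k + 1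
          split_ifs at hx <;> omega
        · rintro ⟨h0, h1⟩
          have h1' : (i : ℕ) ≠ k + 1 := h1
          by_cases hi : (i : ℕ) ≤ k
          · exact ⟨⟨i - 1, by omega⟩, by dsimp only; split_ifs <;> omega⟩
          · exact ⟨⟨i - 2, by omega⟩, by dsimp only; split_ifs <;> omega⟩
      weight_eq := by
        intro x
        have hx := x.2
        rw [NilTorsion.weight_singleton]
        simp only [Fin.ext_iff, Fin.lt_def, r, List.get_eq_getElem]
        -- The cases are σ(x) < p, σ(x) = p and σ(x) > q. The entry of w drops by 2 in the outer
        -- cases; in the middle one the shift by α and the renumbering cancel, and 3 stays 3.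
        rcases lt_trichotomy ((x : ℕ) + 1) k with h1 | h1 | h1
        · have h2 : (σ x : ℕ) = x + 1 := if_pos (by omega)
          have h3 : (x : ℕ) < a.length := by omega
          simp only [h2, hw, hw']
          rw [if_neg (by omega), if_neg (by omega), if_pos h1]
          simp [h3]
          ring
        · have h2 : (σ x : ℕ) = x + 1 := if_pos (by omega)
          have h3 : (x : ℕ) = a.length := by omega
          simp only [h2, hw, hw']
          rw [if_neg (by omega), if_pos h1.symm, if_neg (by omega)]
          simp [h3]
          ring
        · obtain ⟨c, hc⟩ : ∃ c, (x : ℕ) = a.length + (c + 1) := ⟨x - (a.length + 1), by omega⟩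
          have h2 : (σ x : ℕ) = a.length + (c + 2) + 1 :=
            (if_neg (by omega)).trans (by omega)
          simp only [h2, hw, hw', hc]
          rw [if_neg (by omega), if_neg (by omega), if_neg (by omega)]
          simp
          ring }
  exact h.homology_iso j
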